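/- Let $\mathbb S^3\subset\mathbb H$ be the unit quaternions, let $\langle\cdot,\cdot\rangle$ denote the Euclidean inner product on $\mathbb H$ and the usual Euclidean product metric on $\mathbb S^3\times\mathbb S^3$, and equip $\mathbb S^3\times\mathbb S^3$ with the nearly Kähler metric $$g(Z,Z')=\tfrac12\big(\langle Z,Z'\rangle+\langle JZ,JZ'\rangle\big),\qquad J(U,V)_{(p,q)}=\tfrac1{\sqrt3}\big(2pq^{-1}V-U,\,-2qp^{-1}U+V\big).$$ By a geodesic line we mean a non-constant smooth curve $\gamma:\mathbb R\to\mathbb S^3\times\mathbb S^3$ with $\nabla_{\gamma'}\gamma'=0$, where $\nabla$ is the Levi-Civita connection of $g$. Let $\gamma$ be a geodesic line with $\gamma(t_0)=(1,1)$, let $\gamma'(t_0)=(\alpha,\beta)\in \mathrm{Im}\,\mathbb H\times \mathrm{Im}\,\mathbb H$, and put $c_1=\alpha+\beta$, and, if $c_1\neq0$, $d_1=\langle\alpha-\beta,c_1\rangle/\|c_1\|^2\in\mathbb R$ and $c_2=\alpha-\beta-d_1c_1$. Then $c_1,c_2\in\mathrm{Im}\,\mathbb H$ and there is a unit quaternion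 $h$ such that, for all $t\in\mathbb R$, $\gamma(t_0+t)=(h\,x(t)\,h^{-1},\,h\,y(t)\,h^{-1})$, where: 1. if $c_1=0$, then, for some $a\in\mathbb R\setminus\{0\}$, $$(x(t),y(t))=(\cos(at)+\sin(at)i,\ \cos(at)-\sin(at)i);$$ 2. if $c_1\ne0$ and $c_2=0$, then $$(x(t),y(t))=(\cos(at)+\sin(at)i,\ \cos(\tilde at)+\sin(\tilde at)i),\qquad a=\tfrac{1+d_1}2\|c_1\|,\quad \tilde a=\tfrac{1-d_1}2\|c_1\|;$$ 3. if $c_1\neq0$ and $c_2\ne0$, then $$x(t)=\tfrac{1}{1+\varphi^2}\cos(At)+\tfrac{\varphi^2}{1+\varphi^2}\cos(Bt)+\Big(\tfrac{1}{1+\varphi^2}\sin(At)+\tfrac{\varphi^2}{1+\varphi^2}\sin(Bt)\Big)i+\Big(\tfrac{\varphi}{1+\varphi^2}\sin(At)-\tfrac{\varphi}{1+\varphi^2}\sin(Bt)\Big)j-\Big(-\tfrac{\varphi}{1+\varphi^2}\cos(At)+\tfrac{\varphi}{1+\varphi^2}\cos(Bt)\Big)k,$$ and $y(t)$ is given by the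 same formula with $\tilde A,\tilde B,\tilde\varphi$ in place of $A,B,\varphi$. Here $a=\frac{1+d_1}{2}\|c_1\|$, $b=\frac12\|c_2\|$, $c=\frac23\|c_1\|$, $$A=\frac{c+\sqrt{(2a-c)^2+4b^2}}2,\qquad B=\frac{c-\sqrt{(2a-c)^2+4b^2}}2,\qquad \varphi=\frac{c-2a+\sqrt{(c-2a)^2+4b^2}}{2b},$$ and $\tilde A,\tilde B,\tilde\varphi$ are given by the same formulas from $\tilde a=\frac{1-d_1}{2}\|c_1\|$, $\tilde b=-\frac12\|c_2\|$, $\tilde c=c$. Conversely, for every unit quaternion $h$, every $a\in\mathbb R\setminus\{0\}$, all $c_1,c_2\in\mathrm{Im}\,\mathbb H\setminus\{0\}$ and every $d_1\in\mathbb R$, the curves $t\mapsto(h\,x(t)\,h^{-1},h\,y(t)\,h^{-1})$ with $(x,y)$ as displayed in 1, 2 and 3 are geodesic lines passing through $(1,1)$ at $t=0$. -/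

import Mathlib

open scoped ContDiff Topology

noncomputable section

namespace NearlyKahler

/-- The quaternions, with their standard Euclidean inner product (identified with `ℝ⁴`). -/
abbrev HH : Type := Quaternion ℝ

/-- The ambient space `ℍ × ℍ` (identified with `ℝ⁸`). -/
abbrev Amb : Type := HH × HH

/-- `S³ × S³` as the set of pairs of unit quaternions. -/
def M : Set Amb := {z | ‖z.1‖ = 1 ∧ ‖z.2‖ = 1}

/-- The tangent space of `S³ × S³` at `z = (p, q)`: pairs `(U, V)` with `U ⟂ p` and `V ⟂ q`. -/
def TS (z : Amb) : Submodule ℝ Amb where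
  carrier := {Z | inner ℝ z.1 Z.1 = 0 ∧ inner ℝ z.2 Z.2 = 0}
  add_mem' := by
    rintro a b ⟨h1, h2⟩ ⟨h3, h4⟩
    constructor <;> simp [inner_add_right, *]
  zero_mem' := by simp
  smul_mem' := by
    rintro c a ⟨h1, h2⟩
    constructor <;> simp [inner_smul_right, *]

/-- The usual Euclidean product metric. -/
def euclid (Z W : Amb) : ℝ := inner ℝ Z.1 W.1 + inner ℝ Z.2 W.2

/-- The almost complex structure
`J(U, V) = (1 / √3) (2 p q⁻¹ V - U, -2 q p⁻¹ U + V)` at the point `z = (p, q)`. -/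
def J (z Z : Amb) : Amb :=
  (1 / √3 : ℝ) •
    ((2 : ℝ) • (z.1 * z.2⁻¹ * Z.2) - Z.1, -((2 : ℝ) • (z.2 * z.1⁻¹ * Z.1)) + Z.2)

/-- The nearly Kähler metric `g(Z, W) = (⟨Z, W⟩ + ⟨JZ, JW⟩) / 2` at the point `z`. -/
def metric (z Z W : Amb) : ℝ := (euclid Z W + euclid (J z Z) (J z W)) / 2

/-- Smooth functions near `S³ × S³`. Smooth functions (vector fields) on the submanifold are
represented by maps on the ambient space that are smooth near it; only their restrictions to the
submanifold matter, since they are only differentiated in tangent directions. -/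
def SmoothNear {F : Type} [NormedAddCommGroup F] [NormedSpace ℝ F] (f : Amb → F) : Prop :=
  ∀ z ∈ M, ContDiffAt ℝ ∞ f z

/-- `X` represents a smooth vector field tangent to `S³ × S³`. -/
structure IsVectorField (X : Amb → Amb) : Prop where
  smooth : SmoothNear X
  tangent : ∀ z ∈ M, X z ∈ TS z

/-- An affine connection on `S³ × S³`; `cov Y z u` is `(∇_u Y)(z)` for a tangent vector `u` at
`z ∈ S³ × S³` and a smooth vector field `Y`. -/
structure IsConnection (cov : (Amb → Amb) → Amb → Amb → Amb) : Prop where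
  field : ∀ X Y, IsVectorField X → IsVectorField Y → IsVectorField (fun z => cov Y z (X z))
  add_dir : ∀ Y, IsVectorField Y → ∀ z ∈ M, ∀ u ∈ TS z, ∀ v ∈ TS z,
    cov Y z (u + v) = cov Y z u + cov Y z v
  smul_dir : ∀ Y, IsVectorField Y → ∀ z ∈ M, ∀ u ∈ TS z, ∀ c : ℝ,
    cov Y z (c • u) = c • cov Y z u
  add : ∀ Y Y', IsVectorField Y → IsVectorField Y' → ∀ z ∈ M, ∀ u ∈ TS z,
    cov (fun w => Y w + Y' w) z u = cov Y z u + cov Y' z u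
  leibniz : ∀ (f : Amb → ℝ) Y, SmoothNear f → IsVectorField Y → ∀ z ∈ M, ∀ u ∈ TS z,
    cov (fun w => f w • Y w) z u = f z • cov Y z u + (fderiv ℝ f z u) • Y z

/-- The Levi-Civita connection of the nearly Kähler metric: the torsion-free affine connection
that is compatible with the metric. -/
structure IsLeviCivita (cov : (Amb → Amb) → Amb → Amb → Amb) : Prop extends IsConnection cov where
  torsion_free : ∀ X Y, IsVectorField X → IsVectorField Y → ∀ z ∈ M,
    cov Y z (X z) - cov X z (Y z) = VectorField.lieBracket ℝ X Y z
  metric_compatible : ∀ Y Z, IsVectorField Y → IsVectorField Z → ∀ z ∈ M, ∀ u ∈ TS z,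
    fderiv ℝ (fun w => metric w (Y w) (Z w)) z u =
      metric z (cov Y z u) (Z z) + metric z (Y z) (cov Z z u)

/-! ### Existence of the Levi-Civita connection -/

/-- Half the commutator; the cross product on imaginary quaternions. -/
def cr (a b : HH) : HH := (1 / 2 : ℝ) • (a * b - b * a)

def B1 (a b c d : HH) : HH := cr a c - (1 / 3 : ℝ) • cr a d + (1 / 3 : ℝ) • cr b c

def B2 (a b c d : HH) : HH := cr b d + (1 / 3 : ℝ) • cr a d - (1 / 3 : ℝ) • cr b c

/-- A formula for the Levi-Civita connection, used only to show that one exists. -/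
def covAux (Y : Amb → Amb) (z u : Amb) : Amb :=
  ((fderiv ℝ Y z u).1 - u.1 * star z.1 * (Y z).1 +
      z.1 * B1 (star z.1 * u.1) (star z.2 * u.2) (star z.1 * (Y z).1) (star z.2 * (Y z).2),
   (fderiv ℝ Y z u).2 - u.2 * star z.2 * (Y z).2 +
      z.2 * B2 (star z.1 * u.1) (star z.2 * u.2) (star z.1 * (Y z).1) (star z.2 * (Y z).2))

theorem unit_star_mul {p : HH} (hp : ‖p‖ = 1) : star p * p = 1 := by
  rw [Quaternion.star_mul_self, Quaternion.normSq_eq_norm_mul_self, hp]; simp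

theorem unit_mul_star {p : HH} (hp : ‖p‖ = 1) : p * star p = 1 := by
  rw [Quaternion.self_mul_star, Quaternion.normSq_eq_norm_mul_self, hp]; simp

theorem unit_inv {p : HH} (hp : ‖p‖ = 1) : p⁻¹ = star p :=
  inv_eq_of_mul_eq_one_right (unit_mul_star hp)

theorem re_eq_zero_of_perp {p U : HH} (h : inner ℝ p U = 0) : (star p * U).re = 0 := by
  rw [Quaternion.inner_def] at h
  simp only [Quaternion.re_mul, Quaternion.re_star, Quaternion.imI_star, Quaternion.imJ_star,
    Quaternion.imK_star] at h ⊢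
  linarith

theorem inner_unit_mul {p : HH} (hp : ‖p‖ = 1) (a b : HH) :
    inner ℝ (p * a) (p * b) = inner ℝ a b := by
  have h : p.re ^ 2 + p.imI ^ 2 + p.imJ ^ 2 + p.imK ^ 2 = 1 := by
    rw [← Quaternion.normSq_def', Quaternion.normSq_eq_norm_mul_self, hp]; simp
  simp only [Quaternion.inner_def, Quaternion.re_mul, Quaternion.imI_mul, Quaternion.imJ_mul,
    Quaternion.imK_mul, Quaternion.re_star, Quaternion.imI_star, Quaternion.imJ_star,
    Quaternion.imK_star]
  linear_combination (a.re * b.re + a.imI * b.imI + a.imJ * b.imJ + a.imK * b.imK) * h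

/-- The metric in the left trivialization. -/
def L (a b c d : HH) : ℝ :=
  4 / 3 * (inner ℝ a c + inner ℝ b d) - 2 / 3 * (inner ℝ a d + inner ℝ c b)

theorem metric_eq {z : Amb} (hz : z ∈ M) (Z W : Amb) :
    metric z Z W = L (star z.1 * Z.1) (star z.2 * Z.2) (star z.1 * W.1) (star z.2 * W.2) := by
  obtain ⟨p, q⟩ := z
  obtain ⟨U, V⟩ := Z
  obtain ⟨U', V'⟩ := W
  obtain ⟨hp, hq⟩ := hz
  simp only at hp hq
  obtain ⟨a, rfl⟩ : ∃ a, U = p * a := ⟨star p * U, by rw [← mul_assoc, unit_mul_star hp, one_mul]⟩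
  obtain ⟨b, rfl⟩ : ∃ a, V = q * a := ⟨star q * V, by rw [← mul_assoc, unit_mul_star hq, one_mul]⟩
  obtain ⟨c, rfl⟩ : ∃ a, U' = p * a :=
    ⟨star p * U', by rw [← mul_assoc, unit_mul_star hp, one_mul]⟩
  obtain ⟨d, rfl⟩ : ∃ a, V' = q * a :=
    ⟨star q * V', by rw [← mul_assoc, unit_mul_star hq, one_mul]⟩
  have e (p a : HH) (hp : ‖p‖ = 1) : star p * (p * a) = a := by
    rw [← mul_assoc, unit_star_mul hp, one_mul]
  obtain ⟨s, hs⟩ : ∃ s : ℝ, s = 1 / √3 := ⟨_, rfl⟩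
  have h3 : s * s = 1 / 3 := by
    rw [hs, div_mul_div_comm, Real.mul_self_sqrt (by norm_num)]; norm_num
  have f1 (v u : HH) : (2 : ℝ) • (p * star q * (q * v)) - p * u = p * ((2 : ℝ) • v - u) := by
    rw [mul_assoc, e q v hq, mul_sub, mul_smul_comm]
  have f2 (v u : HH) : -((2 : ℝ) • (q * star p * (p * u))) + q * v = q * (-((2 : ℝ) • u) + v) := by
    rw [mul_assoc, e p u hp, mul_add, mul_neg, mul_smul_comm]
  simp only [metric, euclid, J, unit_inv hp, unit_inv hq, f1, f2, Prod.smul_fst, Prod.smul_snd,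
    ← hs, inner_smul_left, inner_smul_right, inner_unit_mul hp, inner_unit_mul hq, e _ _ hp, e _ _ hq, L,
    inner_sub_left, inner_sub_right, inner_add_left, inner_add_right, inner_neg_left,
    inner_neg_right, conj_trivial, real_inner_comm b c]
  linear_combination (1 / 2 * (5 * inner ℝ a c + 5 * inner ℝ b d - 4 * inner ℝ a d -
    4 * inner ℝ b c)) * h3

theorem hasDerivAt_fst' {c : ℝ → Amb} {u : Amb} {t : ℝ} (h : HasDerivAt c u t) :
    HasDerivAt (fun s => (c s).1) u.1 t :=
  (ContinuousLinearMap.fst ℝ HH HH).hasFDerivAt.comp_hasDerivAt t h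

theorem hasDerivAt_snd' {c : ℝ → Amb} {u : Amb} {t : ℝ} (h : HasDerivAt c u t) :
    HasDerivAt (fun s => (c s).2) u.2 t :=
  (ContinuousLinearMap.snd ℝ HH HH).hasFDerivAt.comp_hasDerivAt t h

/-- Quaternionic conjugation as a continuous linear map. -/
def conjL : HH →L[ℝ] HH :=
  LinearMap.toContinuousLinearMap
    { toFun := fun q => star q
      map_add' := fun a b => star_add a b
      map_smul' := fun r a => Quaternion.star_smul r a }

theorem hasDerivAt_conj {c : ℝ → HH} {u : HH} {t : ℝ} (h : HasDerivAt c u t) :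
    HasDerivAt (fun s => star (c s)) (star u) t :=
  conjL.hasFDerivAt.comp_hasDerivAt t h

/-- A curve in `S³ × S³` with prescribed tangent vector at time `0`. -/
theorem exists_curve {z u : Amb} (hz : z ∈ M) (hu : u ∈ TS z) :
    ∃ c : ℝ → Amb, (∀ t, c t ∈ M) ∧ c 0 = z ∧ HasDerivAt c u 0 := by
  have key (p U : HH) (hp : ‖p‖ = 1) (h : inner ℝ p U = 0) :
      ∃ c : ℝ → HH, (∀ t, ‖c t‖ = 1) ∧ c 0 = p ∧ HasDerivAt c U 0 := by
    refine ⟨fun t => p * NormedSpace.exp (t • (star p * U)), fun t => ?_, by simp, ?_⟩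
    · rw [norm_mul, hp, Quaternion.norm_exp]
      simp [re_eq_zero_of_perp h]
    · have := (hasDerivAt_exp_smul_const (𝕂 := ℝ) (star p * U) (0 : ℝ)).const_mul p
      simpa [← mul_assoc, unit_mul_star hp] using this
  obtain ⟨c, c1, c2, c3⟩ := key z.1 u.1 hz.1 hu.1
  obtain ⟨d, d1, d2, d3⟩ := key z.2 u.2 hz.2 hu.2
  exact ⟨fun t => (c t, d t), fun t => ⟨c1 t, d1 t⟩, by ext1 <;> simp [c2, d2], c3.prodMk d3⟩

theorem mem_tangent_covAux {Y : Amb → Amb} (hY : IsVectorField Y) {z u : Amb} (hz : z ∈ M)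
    (hu : u ∈ TS z) : covAux Y z u ∈ TS z := by
  have hd : DifferentiableAt ℝ Y z := (hY.smooth z hz).differentiableAt (by simp)
  obtain ⟨c, c1, c2, c3⟩ := exists_curve hz hu
  have hYc : HasDerivAt (fun t => Y (c t)) (fderiv ℝ Y z u) 0 := by
    exact hd.hasFDerivAt.comp_hasDerivAt_of_eq (0 : ℝ) c3 c2.symm
  have k1 : inner ℝ z.1 (fderiv ℝ Y z u).1 + inner ℝ u.1 (Y z).1 = 0 := by
    have h := (hasDerivAt_fst' c3).inner ℝ (hasDerivAt_fst' hYc)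
    have h0 : (fun t => inner ℝ (c t).1 (Y (c t)).1) = fun _ => (0 : ℝ) :=
      funext fun t => (hY.tangent _ (c1 t)).1
    rw [h0] at h
    simpa [c2] using h.unique (hasDerivAt_const _ _)
  have k2 : inner ℝ z.2 (fderiv ℝ Y z u).2 + inner ℝ u.2 (Y z).2 = 0 := by
    have h := (hasDerivAt_snd' c3).inner ℝ (hasDerivAt_snd' hYc)
    have h0 : (fun t => inner ℝ (c t).2 (Y (c t)).2) = fun _ => (0 : ℝ) :=
      funext fun t => (hY.tangent _ (c1 t)).2
    rw [h0] at h
    simpa [c2] using h.unique (hasDerivAt_const _ _)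
  have key (p U V W b : HH) (hp : ‖p‖ = 1) (hU : inner ℝ p U = 0) (hV : inner ℝ p V = 0)
      (hW : inner ℝ p W + inner ℝ U V = 0) (hb : b.re = 0) :
      inner ℝ p (W - U * star p * V + p * b) = 0 := by
    obtain ⟨a, rfl⟩ : ∃ a, U = p * a :=
      ⟨star p * U, by rw [← mul_assoc, unit_mul_star hp, one_mul]⟩
    obtain ⟨d, rfl⟩ : ∃ a, V = p * a :=
      ⟨star p * V, by rw [← mul_assoc, unit_mul_star hp, one_mul]⟩
    have ha := re_eq_zero_of_perp hU
    have hd := re_eq_zero_of_perp hV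
    rw [← mul_assoc, unit_star_mul hp, one_mul] at ha hd
    rw [inner_unit_mul hp] at hW
    have e1 : p * a * star p * (p * d) = p * (a * d) := by
      rw [mul_assoc, ← mul_assoc (star p), unit_star_mul hp, one_mul, mul_assoc]
    have e2 (x : HH) : inner ℝ p (p * x) = x.re := by
      have := inner_unit_mul hp 1 x
      rw [mul_one] at this
      rw [this, Quaternion.inner_def]; simp
    rw [e1, inner_add_right, inner_sub_right, e2, e2, hb]
    simp only [Quaternion.inner_def, Quaternion.re_mul, Quaternion.re_star, Quaternion.imI_star,
      Quaternion.imJ_star, Quaternion.imK_star, ha, hd] at hW ⊢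
    linarith
  have ty := hY.tangent z hz
  refine ⟨key _ _ _ _ _ hz.1 hu.1 ty.1 k1 ?_, key _ _ _ _ _ hz.2 hu.2 ty.2 k2 ?_⟩
  · simp only [B1, cr, Quaternion.re_add, Quaternion.re_sub, Quaternion.re_smul, Quaternion.re_mul,
      smul_eq_mul]
    ring
  · simp only [B2, cr, Quaternion.re_add, Quaternion.re_sub, Quaternion.re_smul, Quaternion.re_mul,
      smul_eq_mul]
    ring

theorem contDiffAt_star {f : Amb → HH} {z : Amb} (hf : ContDiffAt ℝ ∞ f z) :
    ContDiffAt ℝ ∞ (fun w => star (f w)) z :=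
  conjL.contDiff.contDiffAt.comp z hf

theorem contDiffAt_cr {f g : Amb → HH} {z : Amb} (hf : ContDiffAt ℝ ∞ f z)
    (hg : ContDiffAt ℝ ∞ g z) : ContDiffAt ℝ ∞ (fun w => cr (f w) (g w)) z :=
  ((hf.mul hg).sub (hg.mul hf)).const_smul _

theorem isVectorField_covAux {X Y : Amb → Amb} (hX : IsVectorField X) (hY : IsVectorField Y) :
    IsVectorField (fun z => covAux Y z (X z)) := by
  refine ⟨fun z hz => ?_, fun z hz => mem_tangent_covAux hY hz (hX.tangent z hz)⟩
  have hx := hX.smooth z hz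
  have hy := hY.smooth z hz
  have hd : ContDiffAt ℝ ∞ (fun w => fderiv ℝ Y w (X w)) z :=
    (hy.fderiv_right (m := ∞) (by simp)).clm_apply hx
  have s1 : ContDiffAt ℝ ∞ (fun w : Amb => star w.1) z := contDiffAt_star contDiffAt_fst
  have s2 : ContDiffAt ℝ ∞ (fun w : Amb => star w.2) z := contDiffAt_star contDiffAt_snd
  have a := s1.mul hx.fst
  have b := s2.mul hx.snd
  have c := s1.mul hy.fst
  have d := s2.mul hy.snd
  have hac := contDiffAt_cr a c
  have had := contDiffAt_cr a d
  have hbc := contDiffAt_cr b c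
  have hbd := contDiffAt_cr b d
  refine ContDiffAt.prodMk ?_ ?_
  · exact (hd.fst.sub ((hx.fst.mul s1).mul hy.fst)).add
      (contDiffAt_fst.mul ((hac.sub (had.const_smul _)).add (hbc.const_smul _)))
  · exact (hd.snd.sub ((hx.snd.mul s2).mul hy.snd)).add
      (contDiffAt_snd.mul ((hbd.add (had.const_smul _)).sub (hbc.const_smul _)))

theorem isConnection_covAux : IsConnection covAux where
  field X Y hX hY := isVectorField_covAux hX hY
  add_dir Y _ z _ u _ v _ := by
    ext1 <;> simp only [covAux, map_add, Prod.fst_add, Prod.snd_add, B1, B2, cr, smul_sub, mul_add,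
      mul_sub, add_mul, smul_add, mul_smul_comm] <;> abel
  smul_dir Y _ z _ u _ c := by
    ext1 <;> simp only [covAux, map_smul, Prod.smul_fst, Prod.smul_snd, B1, B2, cr, smul_sub,
      mul_add, mul_sub, smul_add, mul_smul_comm, smul_mul_assoc, smul_comm _ c]
  add Y Y' hY hY' z hz u _ := by
    have d1 : DifferentiableAt ℝ Y z := (hY.smooth z hz).differentiableAt (by simp)
    have d2 : DifferentiableAt ℝ Y' z := (hY'.smooth z hz).differentiableAt (by simp)
    ext1 <;> simp only [covAux, fderiv_fun_add d1 d2, add_apply, Prod.fst_add,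
      Prod.snd_add, B1, B2, cr, smul_sub, mul_add,
      mul_sub, add_mul, smul_add, mul_smul_comm] <;> abel
  leibniz f Y hf hY z hz u _ := by
    have d1 : DifferentiableAt ℝ Y z := (hY.smooth z hz).differentiableAt (by simp)
    have d2 : DifferentiableAt ℝ f z := (hf z hz).differentiableAt (by simp)
    ext1 <;> simp only [covAux, fderiv_fun_smul d2 d1, add_apply, Prod.fst_add,
      Prod.snd_add, Prod.smul_fst, Prod.smul_snd, B1, B2, cr, smul_sub, mul_add,
      smul_apply, ContinuousLinearMap.smulRight_apply,
      mul_sub, smul_add, mul_smul_comm, smul_mul_assoc, smul_comm _ (f z)] <;>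
      abel

theorem covAux_torsion {X Y : Amb → Amb} {z : Amb} (hz : z ∈ M) :
    covAux Y z (X z) - covAux X z (Y z) = VectorField.lieBracket ℝ X Y z := by
  have e (p U V : HH) (hp : ‖p‖ = 1) : p * (star p * U * (star p * V)) = U * star p * V := by
    rw [← mul_assoc, ← mul_assoc p, unit_mul_star hp, one_mul, ← mul_assoc]
  ext1
  · simp only [covAux, VectorField.lieBracket_eq, Prod.fst_sub, B1, cr, mul_add, mul_sub,
      mul_smul_comm, e _ _ _ hz.1]
    module
  · simp only [covAux, VectorField.lieBracket_eq, Prod.snd_sub, B2, cr, mul_add, mul_sub,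
      mul_smul_comm, e _ _ _ hz.2]
    module

theorem L_B (a b c d x y : HH) (ha : a.re = 0) (hb : b.re = 0) (hc : c.re = 0) (hd : d.re = 0)
    (hx : x.re = 0) (hy : y.re = 0) (c' d' x' y' : HH) :
    L (star a * c + c') (star b * d + d') x y + L c d (star a * x + x') (star b * y + y') =
      L (c' - a * c + B1 a b c d) (d' - b * d + B2 a b c d) x y +
      L c d (x' - a * x + B1 a b x y) (y' - b * y + B2 a b x y) := by
  simp only [L, B1, B2, cr, Quaternion.inner_def, Quaternion.re_mul, Quaternion.imI_mul,
    Quaternion.imJ_mul, Quaternion.imK_mul, Quaternion.re_star, Quaternion.imI_star,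
    Quaternion.imJ_star, Quaternion.imK_star, Quaternion.re_add, Quaternion.imI_add,
    Quaternion.imJ_add, Quaternion.imK_add, Quaternion.re_sub, Quaternion.imI_sub,
    Quaternion.imJ_sub, Quaternion.imK_sub, Quaternion.re_smul, Quaternion.imI_smul,
    Quaternion.imJ_smul, Quaternion.imK_smul, smul_eq_mul, ha, hb, hc, hd, hx, hy]
  ring

theorem differentiableAt_metric {Y Z : Amb → Amb} {z : Amb} (hz : z ∈ M)
    (hY : DifferentiableAt ℝ Y z) (hZ : DifferentiableAt ℝ Z z) :
    DifferentiableAt ℝ (fun w => metric w (Y w) (Z w)) z := by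
  have n1 : z.1 ≠ 0 := norm_ne_zero_iff.1 (by rw [hz.1]; norm_num)
  have n2 : z.2 ≠ 0 := norm_ne_zero_iff.1 (by rw [hz.2]; norm_num)
  have i1 : DifferentiableAt ℝ (fun w : Amb => w.1⁻¹) z := (differentiableAt_inv n1).comp z differentiableAt_fst
  have i2 : DifferentiableAt ℝ (fun w : Amb => w.2⁻¹) z := (differentiableAt_inv n2).comp z differentiableAt_snd
  have hJ (Y : Amb → Amb) (hY : DifferentiableAt ℝ Y z) :
      DifferentiableAt ℝ (fun w => J w (Y w)) z := by
    have h1 := hY.fst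
    have h2 := hY.snd
    unfold J
    fun_prop
  have hE (Y Z : Amb → Amb) (hY : DifferentiableAt ℝ Y z) (hZ : DifferentiableAt ℝ Z z) :
      DifferentiableAt ℝ (fun w => euclid (Y w) (Z w)) z :=
    (hY.fst.inner ℝ hZ.fst).add (hY.snd.inner ℝ hZ.snd)
  have h1 := hE _ _ hY hZ
  have h2 := hE _ _ (hJ _ hY) (hJ _ hZ)
  simp only [metric, div_eq_mul_inv]
  exact (h1.fun_add h2).mul_const (2⁻¹ : ℝ)

theorem covAux_metric {Y Z : Amb → Amb} (hY : IsVectorField Y) (hZ : IsVectorField Z) {z u : Amb}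
    (hz : z ∈ M) (hu : u ∈ TS z) :
    fderiv ℝ (fun w => metric w (Y w) (Z w)) z u =
      metric z (covAux Y z u) (Z z) + metric z (Y z) (covAux Z z u) := by
  have dY : DifferentiableAt ℝ Y z := (hY.smooth z hz).differentiableAt (by simp)
  have dZ : DifferentiableAt ℝ Z z := (hZ.smooth z hz).differentiableAt (by simp)
  obtain ⟨c, c1, c2, c3⟩ := exists_curve hz hu
  have hc (F : Type) [NormedAddCommGroup F] [NormedSpace ℝ F] (f : Amb → F)
      (hf : DifferentiableAt ℝ f z) : HasDerivAt (fun t => f (c t)) (fderiv ℝ f z u) 0 := by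
    exact hf.hasFDerivAt.comp_hasDerivAt_of_eq (0 : ℝ) c3 c2.symm
  have hm := hc _ _ (differentiableAt_metric hz dY dZ)
  have hm2 : (fun t => metric (c t) (Y (c t)) (Z (c t))) = fun t =>
      L (star (c t).1 * (Y (c t)).1) (star (c t).2 * (Y (c t)).2)
        (star (c t).1 * (Z (c t)).1) (star (c t).2 * (Z (c t)).2) :=
    funext fun t => metric_eq (c1 t) _ _
  rw [hm2] at hm
  have y1 := (hasDerivAt_conj (hasDerivAt_fst' c3)).mul (hasDerivAt_fst' (hc _ _ dY))
  have y2 := (hasDerivAt_conj (hasDerivAt_snd' c3)).mul (hasDerivAt_snd' (hc _ _ dY))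
  have z1 := (hasDerivAt_conj (hasDerivAt_fst' c3)).mul (hasDerivAt_fst' (hc _ _ dZ))
  have z2 := (hasDerivAt_conj (hasDerivAt_snd' c3)).mul (hasDerivAt_snd' (hc _ _ dZ))
  have hL := (((y1.inner ℝ z1).add (y2.inner ℝ z2)).const_mul (4 / 3 : ℝ)).sub
    (((y1.inner ℝ z2).add (z1.inner ℝ y2)).const_mul (2 / 3 : ℝ))
  rw [hm.unique hL]
  simp only [c2, Pi.mul_apply, metric_eq hz]
  have sp (p W U V b : HH) (hp : ‖p‖ = 1) : star p * (W - U * star p * V + p * b) =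
      star p * W - star p * U * (star p * V) + b := by
    rw [mul_add, mul_sub, ← mul_assoc (star p) p, unit_star_mul hp, one_mul]
    simp only [mul_assoc]
  have sU (p U V : HH) (hp : ‖p‖ = 1) : star U * V = star (star p * U) * (star p * V) := by
    rw [star_mul, star_star, mul_assoc, ← mul_assoc p, unit_mul_star hp, one_mul]
  have key := L_B (star z.1 * u.1) (star z.2 * u.2) (star z.1 * (Y z).1) (star z.2 * (Y z).2)
    (star z.1 * (Z z).1) (star z.2 * (Z z).2) (re_eq_zero_of_perp hu.1) (re_eq_zero_of_perp hu.2)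
    (re_eq_zero_of_perp (hY.tangent z hz).1) (re_eq_zero_of_perp (hY.tangent z hz).2)
    (re_eq_zero_of_perp (hZ.tangent z hz).1) (re_eq_zero_of_perp (hZ.tangent z hz).2)
    (star z.1 * (fderiv ℝ Y z u).1) (star z.2 * (fderiv ℝ Y z u).2)
    (star z.1 * (fderiv ℝ Z z u).1) (star z.2 * (fderiv ℝ Z z u).2)
  simp only [covAux, sp _ _ _ _ _ hz.1, sp _ _ _ _ _ hz.2]
  rw [← key]
  simp only [← sU _ _ _ hz.1, ← sU _ _ _ hz.2, L]
  ring

/-- There is a Levi-Civita connection of the nearly Kähler metric. -/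
theorem exists_leviCivita : ∃ cov, IsLeviCivita cov :=
  ⟨covAux, { isConnection_covAux with
    torsion_free := fun _ _ _ _ _ hz => covAux_torsion hz
    metric_compatible := fun _ _ hY hZ _ hz _ hu => covAux_metric hY hZ hz hu }⟩

/-- The Levi-Civita connection of the nearly Kähler metric: `leviCivita Y z u = (∇_u Y)(z)`. -/
def leviCivita : (Amb → Amb) → Amb → Amb → Amb := Classical.choose exists_leviCivita

theorem isLeviCivita_leviCivita : IsLeviCivita leviCivita := Classical.choose_spec exists_leviCivita

/-! ### Geodesics -/

/-- `W` is the covariant derivative at time `t`, along the curve `γ`, of the vector field `V` along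
`γ`. It is determined by linearity, the Leibniz rule and the rule that the covariant derivative
of `Y ∘ γ` is `∇_{γ'} Y` for a vector field `Y`: if `V = ∑ fᵢ (Yᵢ ∘ γ)` near `t`, then
`W = ∑ (fᵢ' Yᵢ + fᵢ ∇_{γ'} Yᵢ)`. -/
def HasCovDerivAlong (γ V : ℝ → Amb) (t : ℝ) (W : Amb) : Prop :=
  ∃ (n : ℕ) (f : Fin n → ℝ → ℝ) (Y : Fin n → Amb → Amb),
    (∀ i, ContDiff ℝ ∞ (f i)) ∧ (∀ i, IsVectorField (Y i)) ∧
    (∀ᶠ s in 𝓝 t, V s = ∑ i, f i s • Y i (γ s)) ∧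
    W = ∑ i, (deriv (f i) t • Y i (γ t) + f i t • leviCivita (Y i) (γ t) (deriv γ t))

/-- A (complete, affinely parametrized) geodesic of the nearly Kähler `S³ × S³`: a smooth curve
with `∇_{γ'} γ' = 0`. -/
structure IsGeodesic (γ : ℝ → Amb) : Prop where
  smooth : ContDiff ℝ ∞ γ
  mem : ∀ t, γ t ∈ M
  geodesic : ∀ t, HasCovDerivAlong γ (deriv γ) t 0

/-! ### The explicit curves -/

/-- The rotation `(x, y) ↦ (h x h⁻¹, h y h⁻¹)`. -/
def rot (h : HH) (z : Amb) : Amb := (h * z.1 * h⁻¹, h * z.2 * h⁻¹)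

/-- `cos s + sin s i`. -/
def circ (s : ℝ) : HH := ⟨Real.cos s, Real.sin s, 0, 0⟩

/-- The frequency `A`. -/
def freqA (a b c : ℝ) : ℝ := (c + √((2 * a - c) ^ 2 + 4 * b ^ 2)) / 2

/-- The frequency `B`. -/
def freqB (a b c : ℝ) : ℝ := (c - √((2 * a - c) ^ 2 + 4 * b ^ 2)) / 2

/-- The parameter `φ`. -/
def phi (a b c : ℝ) : ℝ := (c - 2 * a + √((c - 2 * a) ^ 2 + 4 * b ^ 2)) / (2 * b)

/-- The curve in `S³` that forms either component in the general case. -/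
def comp3 (a b c t : ℝ) : HH :=
  let A := freqA a b c
  let B := freqB a b c
  let φ := phi a b c
  ⟨1 / (1 + φ ^ 2) * Real.cos (A * t) + φ ^ 2 / (1 + φ ^ 2) * Real.cos (B * t),
   1 / (1 + φ ^ 2) * Real.sin (A * t) + φ ^ 2 / (1 + φ ^ 2) * Real.sin (B * t),
   φ / (1 + φ ^ 2) * Real.sin (A * t) - φ / (1 + φ ^ 2) * Real.sin (B * t),
   -(-(φ / (1 + φ ^ 2)) * Real.cos (A * t) + φ / (1 + φ ^ 2) * Real.cos (B * t))⟩

/-- First form. -/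
def curve1 (a t : ℝ) : Amb := (circ (a * t), circ (-(a * t)))

/-- Second form. -/
def curve2 (c₁ : HH) (d₁ t : ℝ) : Amb :=
  (circ ((1 + d₁) / 2 * ‖c₁‖ * t), circ ((1 - d₁) / 2 * ‖c₁‖ * t))

/-- Third form. -/
def curve3 (c₁ c₂ : HH) (d₁ t : ℝ) : Amb :=
  (comp3 ((1 + d₁) / 2 * ‖c₁‖) (1 / 2 * ‖c₂‖) (2 / 3 * ‖c₁‖) t,
   comp3 ((1 - d₁) / 2 * ‖c₁‖) (-(1 / 2) * ‖c₂‖) (2 / 3 * ‖c₁‖) t)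

end NearlyKahler

end

namespace NearlyKahler

/-! ### Uniqueness of the Levi-Civita connection -/

/-! The metric is invariant under left multiplication by `S³ × S³`, so the second-order geodesic
equation becomes a first-order one for the left-trivialized velocity `u = p⁻¹p'`, `v = q⁻¹q'`,
namely `u' = [u, v]/3`, `v' = -[u, v]/3` (`isGeodesic_iff_leftVel`). To get there from the chosen
connection, uniqueness identifies it with the explicit `covAux`.

The sum `c = u + v` is conserved and `[u, v] = [u, c]`, so the system is linear: `u` is the initial
velocity `α` conjugated by `exp(tc/3)`. Integrating once more gives `p = exp(t(α - c/3)) exp(tc/3)`,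
and likewise for `q` (`isGeodesic_expCurve`, `IsGeodesic.eq_expCurve`).

It remains to normalize. Conjugation by a unit quaternion moves the direction of `c₁` to `i` and
that of the orthogonal vector `c₂` to `j` (`exists_rotation_pair`). If `c₁ = 0` or `c₂ = 0`, all
exponents commute and circles result. Otherwise, expanding the product of exponentials and turning
products of sines and cosines into sums yields the frequencies `A`, `B` and weights in `φ`
(`comp3_eq_expCurve`). The converse reads the same identities backwards. -/

theorem metric_sub_left {z : Amb} (hz : z ∈ M) (X Y Z : Amb) :
    metric z (X - Y) Z = metric z X Z - metric z Y Z := by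
  simp only [metric_eq hz, L, Prod.fst_sub, Prod.snd_sub, mul_sub, inner_sub_left, inner_sub_right]
  ring

theorem metric_comm (z X Y : Amb) : metric z X Y = metric z Y X := by
  simp only [metric, euclid, real_inner_comm]

theorem eq_zero_of_metric_self {z X : Amb} (h : metric z X X = 0) : X = 0 := by
  simp only [metric, euclid, real_inner_self_eq_norm_sq] at h
  have h1 : ‖X.1‖ ^ 2 = 0 := by
    nlinarith [sq_nonneg ‖X.1‖, sq_nonneg ‖X.2‖, sq_nonneg ‖(J z X).1‖, sq_nonneg ‖(J z X).2‖]
  have h2 : ‖X.2‖ ^ 2 = 0 := by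
    nlinarith [sq_nonneg ‖X.1‖, sq_nonneg ‖X.2‖, sq_nonneg ‖(J z X).1‖, sq_nonneg ‖(J z X).2‖]
  exact Prod.ext (by simpa using h1) (by simpa using h2)

/-- The left-invariant vector field with value `(a, b)` at `(1, 1)`. -/
noncomputable def leftField (a b : HH) (w : Amb) : Amb := (w.1 * a, w.2 * b)

theorem inner_self_mul (p a : HH) : inner ℝ p (p * a) = ‖p‖ ^ 2 * a.re := by
  rw [← real_inner_self_eq_norm_sq]
  simp only [Quaternion.inner_def, Quaternion.re_mul, Quaternion.imI_mul, Quaternion.imJ_mul,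
    Quaternion.imK_mul, Quaternion.re_star, Quaternion.imI_star, Quaternion.imJ_star,
    Quaternion.imK_star]
  ring

theorem isVectorField_leftField {a b : HH} (ha : a.re = 0) (hb : b.re = 0) :
    IsVectorField (leftField a b) where
  smooth _ _ := (contDiffAt_fst.mul contDiffAt_const).prodMk (contDiffAt_snd.mul contDiffAt_const)
  tangent z _ := by
    refine ⟨?_, ?_⟩
    · simp [leftField, inner_self_mul, ha]
    · simp [leftField, inner_self_mul, hb]

theorem exists_isVectorField_eq {z u : Amb} (hz : z ∈ M) (hu : u ∈ TS z) :
    ∃ X, IsVectorField X ∧ X z = u := by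
  refine ⟨leftField (star z.1 * u.1) (star z.2 * u.2),
    isVectorField_leftField (re_eq_zero_of_perp hu.1) (re_eq_zero_of_perp hu.2), ?_⟩
  ext1 <;> simp [leftField, ← mul_assoc, unit_mul_star hz.1, unit_mul_star hz.2]

/-- Let `D(X, Y)` be the difference of the two derivatives of `Y` along `X`. Torsion-freeness makes
`D` symmetric, and compatibility makes `g(D(X, Y), Z)` skew in `Y, Z`. Applying the two alternately,
three times each, returns to the start with the opposite sign. -/
theorem IsLeviCivita.unique {c c' : (Amb → Amb) → Amb → Amb → Amb} (h : IsLeviCivita c)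
    (h' : IsLeviCivita c') {Y : Amb → Amb} (hY : IsVectorField Y) {z u : Amb} (hz : z ∈ M)
    (hu : u ∈ TS z) : c Y z u = c' Y z u := by
  have sym (X Y : Amb → Amb) (hX : IsVectorField X) (hY : IsVectorField Y) :
      c Y z (X z) - c' Y z (X z) = c X z (Y z) - c' X z (Y z) := by
    have e := (h.torsion_free X Y hX hY z hz).trans (h'.torsion_free X Y hX hY z hz).symm
    rw [sub_eq_sub_iff_sub_eq_sub]
    exact e
  have skew (X Y Z : Amb → Amb) (hX : IsVectorField X) (hY : IsVectorField Y)
      (hZ : IsVectorField Z) : metric z (c Y z (X z) - c' Y z (X z)) (Z z) =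
        - metric z (c Z z (X z) - c' Z z (X z)) (Y z) := by
    have e := (h.metric_compatible Y Z hY hZ z hz _ (hX.tangent z hz)).symm.trans
      (h'.metric_compatible Y Z hY hZ z hz _ (hX.tangent z hz))
    rw [metric_comm z (Y z), metric_comm z (Y z)] at e
    rw [metric_sub_left hz, metric_sub_left hz]
    linarith
  obtain ⟨X, hX, rfl⟩ := exists_isVectorField_eq hz hu
  -- The test field `Z` takes the difference vector itself as its value at `z`, so definiteness of
  -- the metric finishes.
  obtain ⟨Z, hZ, hZz⟩ := exists_isVectorField_eq hz (Submodule.sub_mem _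
    ((h.field X Y hX hY).tangent z hz) ((h'.field X Y hX hY).tangent z hz))
  refine sub_eq_zero.1 (eq_zero_of_metric_self (z := z) ?_)
  have e : metric z (c Y z (X z) - c' Y z (X z)) (Z z) =
      - metric z (c Y z (X z) - c' Y z (X z)) (Z z) := by
    conv_lhs => rw [skew X Y Z hX hY hZ, sym X Z hX hZ, skew Z X Y hZ hX hY, sym Z Y hZ hY,
      skew Y Z X hY hZ hX, sym Y X hY hX]
    ring
  simp only [hZz] at e
  linarith

theorem isLeviCivita_covAux : IsLeviCivita covAux :=
  { isConnection_covAux with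
    torsion_free := fun _ _ _ _ _ hz => covAux_torsion hz
    metric_compatible := fun _ _ hY hZ _ hz _ hu => covAux_metric hY hZ hz hu }

/-- `leviCivita` is obtained by choice, so its values are accessible only through uniqueness. -/
theorem leviCivita_eq_covAux {Y : Amb → Amb} (hY : IsVectorField Y) {z u : Amb} (hz : z ∈ M)
    (hu : u ∈ TS z) : leviCivita Y z u = covAux Y z u :=
  isLeviCivita_leviCivita.unique isLeviCivita_covAux hY hz hu

/-! ### The geodesic equation -/

/-- The difference between the Levi-Civita connection and the flat connection of `ℍ × ℍ`. -/
noncomputable def christoffel (z u : Amb) : Amb →ₗ[ℝ] Amb where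
  toFun y := (-(u.1 * star z.1 * y.1) +
      z.1 * B1 (star z.1 * u.1) (star z.2 * u.2) (star z.1 * y.1) (star z.2 * y.2),
    -(u.2 * star z.2 * y.2) +
      z.2 * B2 (star z.1 * u.1) (star z.2 * u.2) (star z.1 * y.1) (star z.2 * y.2))
  map_add' x y := by
    ext1 <;> simp only [Prod.fst_add, Prod.snd_add, B1, B2, cr, smul_sub, mul_add,
      mul_sub, add_mul, smul_add, mul_smul_comm] <;> abel
  map_smul' c x := by
    ext1 <;> simp only [Prod.smul_fst, Prod.smul_snd, B1, B2, cr, smul_sub, RingHom.id_apply,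
      mul_add, mul_sub, smul_add, smul_neg, mul_smul_comm, smul_mul_assoc, smul_comm _ c]

theorem covAux_eq_christoffel (Y : Amb → Amb) (z u : Amb) :
    covAux Y z u = fderiv ℝ Y z u + christoffel z u (Y z) := by
  ext1 <;> simp only [covAux, christoffel, LinearMap.coe_mk, AddHom.coe_mk, Prod.fst_add,
    Prod.snd_add] <;> abel

theorem deriv_mem_tangent {γ : ℝ → Amb} {t : ℝ} (hγ : DifferentiableAt ℝ γ t)
    (hM : ∀ s, γ s ∈ M) : deriv γ t ∈ TS (γ t) := by
  have key (c : ℝ → HH) (u : HH) (hc : ∀ s, ‖c s‖ = 1) (h : HasDerivAt c u t) :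
      inner ℝ (c t) u = 0 := by
    have h1 := h.inner ℝ h
    have h0 : (fun s => inner ℝ (c s) (c s)) = fun _ => (1 : ℝ) :=
      funext fun s => by rw [real_inner_self_eq_norm_sq, hc]; norm_num
    rw [h0] at h1
    have := h1.unique (hasDerivAt_const _ _)
    rw [real_inner_comm (c t) u] at this
    linarith
  exact ⟨key _ _ (fun s => (hM s).1) (hasDerivAt_fst' hγ.hasDerivAt),
    key _ _ (fun s => (hM s).2) (hasDerivAt_snd' hγ.hasDerivAt)⟩

/-- The product rule applied to `∑ fᵢ (Yᵢ ∘ γ)`, with linearity of `christoffel` in its last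
argument, shows that the covariant derivative does not depend on the chosen decomposition. -/
theorem HasCovDerivAlong.eq_christoffel {γ V : ℝ → Amb} {t : ℝ} {W : Amb}
    (hγ : DifferentiableAt ℝ γ t) (hM : ∀ s, γ s ∈ M) (h : HasCovDerivAlong γ V t W) :
    W = deriv V t + christoffel (γ t) (deriv γ t) (V t) := by
  obtain ⟨n, f, Y, hf, hY, hV, rfl⟩ := h
  have hd : HasDerivAt (fun s => ∑ i, f i s • Y i (γ s))
      (∑ i, (f i t • fderiv ℝ (Y i) (γ t) (deriv γ t) + deriv (f i) t • Y i (γ t))) t := by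
    refine HasDerivAt.fun_sum fun i _ => ?_
    have h1 : HasDerivAt (f i) (deriv (f i) t) t :=
      ((hf i).differentiable (by simp) t).hasDerivAt
    have h2 : HasDerivAt (fun s => Y i (γ s)) (fderiv ℝ (Y i) (γ t) (deriv γ t)) t :=
      (((hY i).smooth _ (hM t)).differentiableAt (by simp)).hasFDerivAt.comp_hasDerivAt t
        hγ.hasDerivAt
    exact h1.smul h2
  rw [Filter.EventuallyEq.deriv_eq hV, hd.deriv, hV.self_of_nhds, map_sum, ← Finset.sum_add_distrib]
  refine Finset.sum_congr rfl fun i _ => ?_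
  rw [leviCivita_eq_covAux (hY i) (hM t) (deriv_mem_tangent hγ hM), covAux_eq_christoffel,
    map_smul, smul_add]
  abel

/-- The quaternion unit `i`. -/
noncomputable def qi : HH := ⟨0, 1, 0, 0⟩

/-- The quaternion unit `j`. -/
noncomputable def qj : HH := ⟨0, 0, 1, 0⟩

/-- The quaternion unit `k`. -/
noncomputable def qk : HH := ⟨0, 0, 0, 1⟩

@[simp] theorem re_qi : qi.re = 0 := rfl

@[simp] theorem imI_qi : qi.imI = 1 := rfl

@[simp] theorem imJ_qi : qi.imJ = 0 := rfl

@[simp] theorem imK_qi : qi.imK = 0 := rfl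

@[simp] theorem re_qj : qj.re = 0 := rfl

@[simp] theorem imI_qj : qj.imI = 0 := rfl

@[simp] theorem imJ_qj : qj.imJ = 1 := rfl

@[simp] theorem imK_qj : qj.imK = 0 := rfl

@[simp] theorem re_qk : qk.re = 0 := rfl

@[simp] theorem imI_qk : qk.imI = 0 := rfl

@[simp] theorem imJ_qk : qk.imJ = 0 := rfl

@[simp] theorem imK_qk : qk.imK = 1 := rfl

theorem eq_sum_inner_of_perp {p U : HH} (hp : ‖p‖ = 1) (hU : inner ℝ p U = 0) :
    U = inner ℝ (p * qi) U • (p * qi) + inner ℝ (p * qj) U • (p * qj) +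
      inner ℝ (p * qk) U • (p * qk) := by
  obtain ⟨a, rfl⟩ : ∃ a, U = p * a := ⟨star p * U, by rw [← mul_assoc, unit_mul_star hp, one_mul]⟩
  have ha : a.re = 0 := by simpa [inner_self_mul, hp] using hU
  simp only [inner_unit_mul hp, ← mul_smul_comm, ← mul_add]
  congr 1
  ext <;> simp [Quaternion.inner_def, ha]

/-- `HasCovDerivAlong` demands a decomposition, so a vanishing formula alone does not give a
geodesic. The global left-invariant frame supplies one, with smooth coefficients given by inner
products. -/
theorem exists_hasCovDerivAlong_deriv {γ : ℝ → Amb} (hγ : ContDiff ℝ ∞ γ) (hM : ∀ s, γ s ∈ M)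
    (t : ℝ) : ∃ W, HasCovDerivAlong γ (deriv γ) t W := by
  have hd : ContDiff ℝ ∞ (deriv γ) := (contDiff_infty_iff_deriv.1 hγ).2
  have c1 (a : HH) : ContDiff ℝ ∞ fun s => inner ℝ ((γ s).1 * a) (deriv γ s).1 :=
    (hγ.fst.mul contDiff_const).inner ℝ hd.fst
  have c2 (a : HH) : ContDiff ℝ ∞ fun s => inner ℝ ((γ s).2 * a) (deriv γ s).2 :=
    (hγ.snd.mul contDiff_const).inner ℝ hd.snd
  refine ⟨_, 6, ![fun s => inner ℝ ((γ s).1 * qi) (deriv γ s).1,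
    fun s => inner ℝ ((γ s).1 * qj) (deriv γ s).1, fun s => inner ℝ ((γ s).1 * qk) (deriv γ s).1,
    fun s => inner ℝ ((γ s).2 * qi) (deriv γ s).2, fun s => inner ℝ ((γ s).2 * qj) (deriv γ s).2,
    fun s => inner ℝ ((γ s).2 * qk) (deriv γ s).2],
    ![leftField qi 0, leftField qj 0, leftField qk 0, leftField 0 qi, leftField 0 qj,
      leftField 0 qk], ?_, ?_, .of_forall fun s => ?_, rfl⟩
  · intro i
    fin_cases i
    exacts [c1 _, c1 _, c1 _, c2 _, c2 _, c2 _]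
  · intro i
    fin_cases i <;> exact isVectorField_leftField rfl rfl
  · have ht := deriv_mem_tangent (hγ.differentiable (by simp) s) hM
    rw [Fin.sum_univ_six]
    ext1
    · simpa [leftField] using eq_sum_inner_of_perp (hM s).1 ht.1
    · simpa [leftField] using eq_sum_inner_of_perp (hM s).2 ht.2

theorem isGeodesic_iff {γ : ℝ → Amb} : IsGeodesic γ ↔ ContDiff ℝ ∞ γ ∧ (∀ t, γ t ∈ M) ∧
    ∀ t, deriv (deriv γ) t + christoffel (γ t) (deriv γ t) (deriv γ t) = 0 := by
  constructor
  · rintro ⟨h1, h2, h3⟩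
    exact ⟨h1, h2, fun t => ((h3 t).eq_christoffel (h1.differentiable (by simp) t) h2).symm⟩
  · rintro ⟨h1, h2, h3⟩
    refine ⟨h1, h2, fun t => ?_⟩
    obtain ⟨W, hW⟩ := exists_hasCovDerivAlong_deriv h1 h2 t
    have := hW.eq_christoffel (h1.differentiable (by simp) t) h2
    rw [h3] at this
    rwa [this] at hW

end NearlyKahler

namespace NearlyKahler

open NormedSpace

/-! ### The geodesic equation in the left trivialization -/

theorem star_eq_neg_of_re {a : HH} (ha : a.re = 0) : star a = -a := by
  ext <;> simp [ha]

/-- For `U = pa` and `W = pw` the first equation is `p(w - a² + b) = 0`, and `p` cancels. When `U =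
p'` and `W = p''`, the left side of the second equation is the derivative of `star p * p'`. -/
theorem left_trivialization_iff {p U W b : HH} (hp : ‖p‖ = 1) (hU : inner ℝ p U = 0) :
    W + (-(U * star p * U) + p * b) = 0 ↔ star U * U + star p * W = -b := by
  obtain ⟨a, rfl⟩ : ∃ a, U = p * a := ⟨star p * U, by rw [← mul_assoc, unit_mul_star hp, one_mul]⟩
  obtain ⟨w, rfl⟩ : ∃ a, W = p * a := ⟨star p * W, by rw [← mul_assoc, unit_mul_star hp, one_mul]⟩
  have ha : a.re = 0 := by simpa [inner_self_mul, hp] using hU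
  have hp0 : p ≠ 0 := norm_ne_zero_iff.1 (by rw [hp]; norm_num)
  have e (x y : HH) : x * star p * (p * y) = x * y := by
    rw [mul_assoc, ← mul_assoc (star p), unit_star_mul hp, one_mul]
  have e1 : p * w + (-(p * a * star p * (p * a)) + p * b) = p * (w - a * a + b) := by
    rw [e, mul_add, mul_sub, mul_assoc]; abel
  rw [e1, star_mul, e, ← mul_assoc, unit_star_mul hp, one_mul, star_eq_neg_of_re ha]
  constructor
  · intro h
    rcases mul_eq_zero.1 h with h | h
    · exact absurd h hp0
    · rw [← sub_eq_zero, ← h]; noncomm_ring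
  · intro h
    rw [← sub_eq_zero] at h
    rw [show w - a * a + b = -a * a + w - -b by noncomm_ring, h, mul_zero]

theorem christoffel_eq_zero_iff {z u W : Amb} (hz : z ∈ M) (hu : u ∈ TS z) :
    W + christoffel z u u = 0 ↔
      star u.1 * u.1 + star z.1 * W.1 = (1 / 3 : ℝ) • (star z.1 * u.1 * (star z.2 * u.2) -
        star z.2 * u.2 * (star z.1 * u.1)) ∧
      star u.2 * u.2 + star z.2 * W.2 = -((1 / 3 : ℝ) • (star z.1 * u.1 * (star z.2 * u.2) -
        star z.2 * u.2 * (star z.1 * u.1))) := by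
  rw [Prod.ext_iff]
  simp only [christoffel, LinearMap.coe_mk, AddHom.coe_mk, Prod.fst_add, Prod.snd_add,
    Prod.fst_zero, Prod.snd_zero]
  rw [left_trivialization_iff hz.1 hu.1, left_trivialization_iff hz.2 hu.2]
  -- On the diagonal `cr a a` vanishes and the two mixed terms add up.
  have h1 (a b : HH) : -B1 a b a b = (1 / 3 : ℝ) • (a * b - b * a) := by
    simp only [B1, cr]; module
  have h2 (a b : HH) : -B2 a b a b = -((1 / 3 : ℝ) • (a * b - b * a)) := by
    simp only [B2, cr]; module
  rw [h1, h2]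

/-- The velocity of a curve in the left trivialization, as a pair of quaternions. -/
noncomputable def leftVel (γ : ℝ → Amb) (t : ℝ) : Amb :=
  (star (γ t).1 * (deriv γ t).1, star (γ t).2 * (deriv γ t).2)

theorem hasDerivAt_leftVel {γ : ℝ → Amb} (hγ : ContDiff ℝ ∞ γ) (t : ℝ) :
    HasDerivAt (leftVel γ)
      (star (deriv γ t).1 * (deriv γ t).1 + star (γ t).1 * (deriv (deriv γ) t).1,
       star (deriv γ t).2 * (deriv γ t).2 + star (γ t).2 * (deriv (deriv γ) t).2) t := by
  have h1 := (hγ.differentiable (by simp) t).hasDerivAt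
  have h2 := ((contDiff_infty_iff_deriv.1 hγ).2.differentiable (by simp) t).hasDerivAt
  exact ((hasDerivAt_conj (hasDerivAt_fst' h1)).mul (hasDerivAt_fst' h2)).prodMk
    ((hasDerivAt_conj (hasDerivAt_snd' h1)).mul (hasDerivAt_snd' h2))

theorem isGeodesic_iff_leftVel {γ : ℝ → Amb} : IsGeodesic γ ↔ ContDiff ℝ ∞ γ ∧ (∀ t, γ t ∈ M) ∧
    ∀ t, HasDerivAt (leftVel γ)
      ((1 / 3 : ℝ) • ((leftVel γ t).1 * (leftVel γ t).2 - (leftVel γ t).2 * (leftVel γ t).1),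
       -((1 / 3 : ℝ) • ((leftVel γ t).1 * (leftVel γ t).2 -
          (leftVel γ t).2 * (leftVel γ t).1))) t := by
  rw [isGeodesic_iff]
  refine and_congr_right fun h1 => and_congr_right fun h2 => forall_congr' fun t => ?_
  have ht := deriv_mem_tangent (h1.differentiable (by simp) t) h2
  rw [christoffel_eq_zero_iff (h2 t) ht]
  have hd := hasDerivAt_leftVel h1 t
  constructor
  · rintro ⟨e1, e2⟩
    rw [e1, e2] at hd
    exact hd
  · intro h
    exact Prod.ext_iff.1 (hd.unique h)

theorem IsGeodesic.comp_const_add {γ : ℝ → Amb} (h : IsGeodesic γ) (t₀ : ℝ) :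
    IsGeodesic fun s => γ (t₀ + s) := by
  rw [isGeodesic_iff] at h ⊢
  have e : deriv (fun s => γ (t₀ + s)) = fun s => deriv γ (t₀ + s) :=
    funext fun s => deriv_comp_const_add γ t₀ s
  refine ⟨h.1.comp (contDiff_const.add contDiff_id), fun t => h.2.1 _, fun t => ?_⟩
  rw [e, deriv_comp_const_add]
  exact h.2.2 _

/-! ### Solutions of the geodesic equation -/

theorem contDiff_exp_smul (x : HH) : ContDiff ℝ ∞ fun t : ℝ => exp (t • x) := by
  have h : ContDiff ℝ ∞ (exp : HH → HH) :=
    contDiff_iff_contDiffAt.2 fun y => (exp_analytic (𝕂 := ℝ) y).contDiffAt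
  exact h.comp (contDiff_id.smul contDiff_const)

theorem exp_neg_mul_exp (x : HH) : exp (-x) * exp x = 1 := by
  let +nondep : NormedAlgebra ℚ HH := .restrictScalars ℚ ℝ HH
  rw [← exp_add_of_commute (Commute.refl x).neg_left, neg_add_cancel, exp_zero]

theorem exp_mul_exp_neg (x : HH) : exp x * exp (-x) = 1 := by
  simpa using exp_neg_mul_exp (-x)

theorem exp_smul_mul_comm (t : ℝ) (x : HH) : exp (t • x) * x = x * exp (t • x) :=
  (hasDerivAt_exp_smul_const (𝕂 := ℝ) x t).unique (hasDerivAt_exp_smul_const' x t)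

theorem norm_exp_of_re {x : HH} (hx : x.re = 0) : ‖exp x‖ = 1 := by
  rw [Quaternion.norm_exp]; simp [hx]

/-- The component with initial velocity `α` of a geodesic through `(1, 1)`, where `c` is the sum
of the initial velocities of the two components. -/
noncomputable def expCurve (α c : HH) (t : ℝ) : HH :=
  exp (t • (α - (1 / 3 : ℝ) • c)) * exp (t • (1 / 3 : ℝ) • c)

/-- The velocity of `expCurve` in the left trivialization. -/
noncomputable def expVel (α c : HH) (t : ℝ) : HH :=
  exp (-(t • (1 / 3 : ℝ) • c)) * α * exp (t • (1 / 3 : ℝ) • c)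

theorem expCurve_zero (α c : HH) : expCurve α c 0 = 1 := by
  simp [expCurve]

theorem contDiff_expCurve (α c : HH) : ContDiff ℝ ∞ (expCurve α c) :=
  (contDiff_exp_smul _).mul (contDiff_exp_smul _)

theorem norm_expCurve {α c : HH} (hα : α.re = 0) (hc : c.re = 0) (t : ℝ) :
    ‖expCurve α c t‖ = 1 := by
  rw [expCurve, norm_mul, norm_exp_of_re, norm_exp_of_re, one_mul] <;> simp [hα, hc]

/-- The `c/3` lost in the first exponent is restored by differentiating the second, which leaves `α`
between the two exponentials. -/
theorem hasDerivAt_expCurve (α c : HH) (t : ℝ) :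
    HasDerivAt (expCurve α c) (expCurve α c t * expVel α c t) t := by
  have h := (hasDerivAt_exp_smul_const (𝕂 := ℝ) (α - (1 / 3 : ℝ) • c) t).mul
    (hasDerivAt_exp_smul_const' (𝕂 := ℝ) ((1 / 3 : ℝ) • c) t)
  refine HasDerivAt.congr_deriv (f := expCurve α c) h ?_
  symm
  rw [expCurve, expVel]
  set E := exp (t • (1 / 3 : ℝ) • c)
  set F := exp (-(t • (1 / 3 : ℝ) • c))
  have hEF : E * F = 1 := exp_mul_exp_neg _
  set P := exp (t • (α - (1 / 3 : ℝ) • c))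
  calc P * E * (F * α * E) = P * (E * F) * α * E := by noncomm_ring
    _ = _ := by rw [hEF]; noncomm_ring

theorem hasDerivAt_expVel (α c : HH) (t : ℝ) :
    HasDerivAt (expVel α c) ((1 / 3 : ℝ) • (expVel α c t * c - c * expVel α c t)) t := by
  have h1 := hasDerivAt_exp_smul_const' (𝕂 := ℝ) (-((1 / 3 : ℝ) • c)) t
  simp only [smul_neg] at h1
  have h := (h1.mul_const α).mul (hasDerivAt_exp_smul_const (𝕂 := ℝ) ((1 / 3 : ℝ) • c) t)
  refine HasDerivAt.congr_deriv (f := expVel α c) h ?_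
  simp only [expVel, mul_smul_comm, smul_mul_assoc, neg_mul, smul_sub, mul_assoc]
  abel

theorem expVel_self (c : HH) (t : ℝ) : expVel c c t = c := by
  have h : Commute (exp (t • (1 / 3 : ℝ) • c)) c := by
    rw [smul_smul]
    rw [Commute, SemiconjBy, exp_smul_mul_comm]
  rw [expVel, mul_assoc, ← h.eq, ← mul_assoc, exp_neg_mul_exp, one_mul]

theorem expVel_add (α β c : HH) (t : ℝ) : expVel (α + β) c t = expVel α c t + expVel β c t := by
  simp only [expVel, mul_add, add_mul]

theorem deriv_expCurve_prod (α β c : HH) (t : ℝ) :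
    HasDerivAt (fun t => (expCurve α c t, expCurve β c t))
      (expCurve α c t * expVel α c t, expCurve β c t * expVel β c t) t :=
  (hasDerivAt_expCurve α c t).prodMk (hasDerivAt_expCurve β c t)

/-- Once the sum is a constant `c`, this makes the quadratic velocity equation linear. -/
theorem commutator_add_right {a b c : HH} (h : a + b = c) : a * b - b * a = a * c - c * a := by
  rw [← h]; noncomm_ring

theorem commutator_add_left {a b c : HH} (h : a + b = c) : b * a - a * b = b * c - c * b := by
  rw [← h]; noncomm_ring

theorem isGeodesic_expCurve {α β : HH} (hα : α.re = 0) (hβ : β.re = 0) :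
    IsGeodesic fun t => (expCurve α (α + β) t, expCurve β (α + β) t) := by
  have hc : (α + β).re = 0 := by simp [hα, hβ]
  rw [isGeodesic_iff_leftVel]
  refine ⟨(contDiff_expCurve _ _).prodMk (contDiff_expCurve _ _),
    fun t => ⟨norm_expCurve hα hc t, norm_expCurve hβ hc t⟩, fun t => ?_⟩
  have e : leftVel (fun t => (expCurve α (α + β) t, expCurve β (α + β) t)) =
      fun t => (expVel α (α + β) t, expVel β (α + β) t) := by
    funext t
    rw [leftVel, (deriv_expCurve_prod α β (α + β) t).deriv]
    simp only [← mul_assoc, unit_star_mul (norm_expCurve hα hc t),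
      unit_star_mul (norm_expCurve hβ hc t), one_mul]
  rw [e]
  have hs : expVel α (α + β) t + expVel β (α + β) t = α + β := by
    rw [← expVel_add, expVel_self]
  refine ((hasDerivAt_expVel α (α + β) t).prodMk
    (hasDerivAt_expVel β (α + β) t)).congr_deriv (Prod.ext ?_ ?_)
  · simp only
    rw [← commutator_add_right hs]
  · simp only
    rw [← commutator_add_left hs, ← smul_neg, neg_sub]

/-- No general uniqueness theorem for ODEs is needed: each equation has an integrating factor made
of exponentials, and a function with zero derivative is constant. -/
theorem IsGeodesic.eq_expCurve {γ : ℝ → Amb} (h : IsGeodesic γ) (h0 : γ 0 = (1, 1)) {α β : HH}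
    (hd : deriv γ 0 = (α, β)) (t : ℝ) :
    γ t = (expCurve α (α + β) t, expCurve β (α + β) t) := by
  obtain ⟨h1, h2, h3⟩ := isGeodesic_iff_leftVel.1 h
  have hv0 : leftVel γ 0 = (α, β) := by simp [leftVel, h0, hd]
  have a1 (t : ℝ) := hasDerivAt_fst' (h3 t)
  have a2 (t : ℝ) := hasDerivAt_snd' (h3 t)
  -- Conservation law: the two right-hand sides are opposite.
  have hsum (t : ℝ) : (leftVel γ t).1 + (leftVel γ t).2 = α + β := by
    have k (t : ℝ) := (a1 t).add (a2 t)
    simp only [add_neg_cancel] at k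
    have := is_const_of_deriv_eq_zero (fun t => (k t).differentiableAt) (fun t => (k t).deriv) t 0
    simpa [hv0] using this
  have ode {f : ℝ → HH} (hf : ∀ t, HasDerivAt f
      ((1 / 3 : ℝ) • (f t * (α + β) - (α + β) * f t)) t) (t : ℝ) :
      f t = expVel (f 0) (α + β) t := by
    have e1 (t : ℝ) := hasDerivAt_exp_smul_const (𝕂 := ℝ) ((1 / 3 : ℝ) • (α + β)) t
    have e2 (t : ℝ) := hasDerivAt_exp_smul_const' (𝕂 := ℝ) (-((1 / 3 : ℝ) • (α + β))) t
    -- Conjugating `f` back by `exp(tc/3)` gives a constant.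
    have k (t : ℝ) := ((e1 t).mul (hf t)).mul (e2 t)
    have z := is_const_of_deriv_eq_zero (fun t => (k t).differentiableAt)
      (fun t => (k t).deriv.trans (by
        simp only [Pi.mul_apply, mul_smul_comm, smul_mul_assoc, neg_mul, smul_sub, mul_assoc,
          mul_neg, mul_sub, sub_mul, add_mul]
        abel)) t 0
    simp only [Pi.mul_apply, zero_smul, exp_zero, one_mul, mul_one, smul_neg, neg_zero] at z
    rw [expVel, ← z]
    simp only [mul_assoc, exp_neg_mul_exp, mul_one]
    rw [← mul_assoc, exp_neg_mul_exp, one_mul]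
  have v1 (t : ℝ) : (leftVel γ t).1 = expVel α (α + β) t := by
    have := ode (f := fun t => (leftVel γ t).1) (fun t => by
      rw [← commutator_add_right (hsum t)]; exact a1 t) t
    simpa [hv0] using this
  have v2 (t : ℝ) : (leftVel γ t).2 = expVel β (α + β) t := by
    have := ode (f := fun t => (leftVel γ t).2) (fun t => by
      rw [← commutator_add_left (hsum t), ← neg_sub, smul_neg]; exact a2 t) t
    simpa [hv0] using this
  have key {p : ℝ → HH} {δ : HH} (hp0 : p 0 = 1)
      (hp : ∀ t, HasDerivAt p (p t * expVel δ (α + β) t) t) (t : ℝ) :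
      p t = expCurve δ (α + β) t := by
    have e1 (t : ℝ) := hasDerivAt_exp_smul_const' (𝕂 := ℝ) (-((1 / 3 : ℝ) • (α + β))) t
    have e2 (t : ℝ) :=
      hasDerivAt_exp_smul_const' (𝕂 := ℝ) (-(δ - (1 / 3 : ℝ) • (α + β))) t
    -- Here `p exp(-tc/3) exp(-t(δ - c/3))` is constant, which is `expCurve` solved for its initial
    -- value.
    have k (t : ℝ) := ((hp t).mul (e1 t)).mul (e2 t)
    have z := is_const_of_deriv_eq_zero (fun t => (k t).differentiableAt)
      (fun t => (k t).deriv.trans (by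
        have hE := exp_mul_exp_neg (t • (1 / 3 : ℝ) • (α + β))
        have hC := exp_smul_mul_comm t (-((1 / 3 : ℝ) • (α + β)))
        simp only [Pi.mul_apply, expVel, smul_neg] at hC ⊢
        rw [← hC]
        set E := exp (t • (1 / 3 : ℝ) • (α + β))
        set F := exp (-(t • (1 / 3 : ℝ) • (α + β)))
        set G := exp (-(t • (δ - (1 / 3 : ℝ) • (α + β))))
        have : p t * (F * δ * E) * F = p t * F * δ := by
          simp only [mul_assoc, hE, mul_one]
        rw [this]
        noncomm_ring)) t 0
    simp only [Pi.mul_apply, zero_smul, exp_zero, mul_one, smul_neg, neg_zero, hp0] at z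
    have w : p t * exp (-(t • (1 / 3 : ℝ) • (α + β))) =
        exp (t • (δ - (1 / 3 : ℝ) • (α + β))) := by
      rw [← one_mul (exp (t • (δ - (1 / 3 : ℝ) • (α + β)))), ← z, mul_assoc, exp_neg_mul_exp,
        mul_one]
    rw [expCurve, ← w, mul_assoc, exp_neg_mul_exp, mul_one]
  have hg (t : ℝ) := (h1.differentiable (by simp) t).hasDerivAt
  ext1
  · refine key (p := fun t => (γ t).1) (by simp [h0]) (fun t => ?_) t
    have := hasDerivAt_fst' (hg t)
    rwa [← v1, leftVel, ← mul_assoc, unit_mul_star (h2 t).1, one_mul]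
  · refine key (p := fun t => (γ t).2) (by simp [h0]) (fun t => ?_) t
    have := hasDerivAt_snd' (hg t)
    rwa [← v2, leftVel, ← mul_assoc, unit_mul_star (h2 t).2, one_mul]

end NearlyKahler

namespace NearlyKahler

open NormedSpace

/-! ### The explicit curves as products of exponentials -/

theorem expCurve_conj {h : HH} (hh : h ≠ 0) (α c : HH) (t : ℝ) :
    expCurve (h * α * h⁻¹) (h * c * h⁻¹) t = h * expCurve α c t * h⁻¹ := by
  let +nondep : NormedAlgebra ℚ HH := .restrictScalars ℚ ℝ HH
  have e1 : t • (h * α * h⁻¹ - (1 / 3 : ℝ) • (h * c * h⁻¹)) =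
      h * (t • (α - (1 / 3 : ℝ) • c)) * h⁻¹ := by
    simp only [mul_smul_comm, smul_mul_assoc, mul_sub, sub_mul]
  have e2 : t • (1 / 3 : ℝ) • (h * c * h⁻¹) = h * (t • (1 / 3 : ℝ) • c) * h⁻¹ := by
    simp only [mul_smul_comm, smul_mul_assoc]
  rw [expCurve, e1, e2, exp_conj _ _ hh, exp_conj _ _ hh, expCurve]
  simp only [mul_assoc, inv_mul_cancel_left₀ hh]

theorem exp_smul_of_re_eq_zero {q : HH} (hq : q.re = 0) (t : ℝ) :
    exp (t • q) = (Real.cos (t * ‖q‖) : HH) + (Real.sin (t * ‖q‖) / ‖q‖) • q := by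
  rw [Quaternion.exp_of_re_eq_zero _ (by simp [hq]), norm_smul, Real.norm_eq_abs, smul_smul]
  -- The norm of `t • q` contains `|t|`; parity of cosine and sine removes the absolute value.
  rcases abs_choice t with h | h <;> rw [h]
  · rcases eq_or_ne t 0 with rfl | ht
    · simp
    · congr 2
      field_simp
  · rw [neg_mul, Real.cos_neg, Real.sin_neg, neg_div_neg_eq]
    rcases eq_or_ne t 0 with rfl | ht
    · simp
    · congr 2
      field_simp

theorem norm_qi : ‖qi‖ = 1 := by
  have := Quaternion.normSq_eq_norm_mul_self qi
  rw [Quaternion.normSq_def'] at this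
  simp at this
  nlinarith [norm_nonneg qi]

@[simp] theorem re_circ (s : ℝ) : (circ s).re = Real.cos s := rfl

@[simp] theorem imI_circ (s : ℝ) : (circ s).imI = Real.sin s := rfl

@[simp] theorem imJ_circ (s : ℝ) : (circ s).imJ = 0 := rfl

@[simp] theorem imK_circ (s : ℝ) : (circ s).imK = 0 := rfl

theorem circ_eq_exp (s : ℝ) : circ s = exp (s • qi) := by
  rw [exp_smul_of_re_eq_zero re_qi, norm_qi]
  ext <;> simp

/-- Both exponents are multiples of `q`, so the exponentials merge and `c` cancels. -/
theorem expCurve_smul_smul (a c : ℝ) (q : HH) (t : ℝ) :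
    expCurve (a • q) (c • q) t = exp ((a * t) • q) := by
  let +nondep : NormedAlgebra ℚ HH := .restrictScalars ℚ ℝ HH
  rw [expCurve, ← exp_add_of_commute]
  · congr 1; module
  · refine Commute.smul_left (Commute.smul_right (Commute.smul_right ?_ _) _) _
    exact ((Commute.refl q).smul_left _).sub_left (((Commute.refl q).smul_left _).smul_left _)
      |>.smul_right _

/-- The first exponent is `t(d i + b j)` with `d = a - c/3`, of norm `|t|R` where `R² = d² + b²`;
the second is `(tc/3) i`. The addition formulas then produce the frequencies `c/3 ± R`. Both square
roots in the definitions equal `2R`, so `φ = (R - d)/b`. The sign of `b` is free, as the second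
component needs `b < 0`. -/
theorem comp3_eq_expCurve (a c t : ℝ) {b : ℝ} (hb : b ≠ 0) :
    comp3 a b (2 / 3 * c) t = expCurve (a • qi + b • qj) (c • qi) t := by
  obtain ⟨d, hd⟩ : ∃ d, d = a - c / 3 := ⟨_, rfl⟩
  obtain ⟨R, hR⟩ : ∃ R, R = √(d ^ 2 + b ^ 2) := ⟨_, rfl⟩
  have hb2 : 0 < b ^ 2 := by positivity
  have hR0 : 0 < R := hR ▸ Real.sqrt_pos.2 (by positivity)
  have hRR : R ^ 2 = d ^ 2 + b ^ 2 := by rw [hR, Real.sq_sqrt (by positivity)]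
  have s1 : √((2 * a - 2 / 3 * c) ^ 2 + 4 * b ^ 2) = 2 * R := by
    rw [show (2 * a - 2 / 3 * c) ^ 2 + 4 * b ^ 2 = (2 * R) ^ 2 by rw [mul_pow, hRR, hd]; ring,
      Real.sqrt_sq (by positivity)]
  have s2 : √((2 / 3 * c - 2 * a) ^ 2 + 4 * b ^ 2) = 2 * R := by rw [← s1]; congr 1; ring
  have hA : freqA a b (2 / 3 * c) * t = t * (c / 3) + t * R := by rw [freqA, s1]; ring
  have hB : freqB a b (2 / 3 * c) * t = t * (c / 3) - t * R := by rw [freqB, s1]; ring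
  have hφ : phi a b (2 / 3 * c) = (R - d) / b := by rw [phi, s2, hd]; field_simp; ring
  -- `R = d` would force `b² = 0`.
  have hdR : R - d ≠ 0 := fun h => hb2.ne' (by nlinarith)
  have e0 : 1 + ((R - d) / b) ^ 2 = 2 * R * (R - d) / b ^ 2 := by
    field_simp; linear_combination -hRR
  have w1 : 1 / (1 + ((R - d) / b) ^ 2) = (R + d) / (2 * R) := by
    rw [e0]; field_simp; linear_combination -hRR
  have w2 : ((R - d) / b) ^ 2 / (1 + ((R - d) / b) ^ 2) = (R - d) / (2 * R) := by
    rw [e0]; field_simp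
  have w3 : (R - d) / b / (1 + ((R - d) / b) ^ 2) = b / (2 * R) := by
    rw [e0]; field_simp
  have e1 : t • (a • qi + b • qj - (1 / 3 : ℝ) • c • qi) = t • (d • qi + b • qj) := by
    rw [hd]; module
  have e2 : t • (1 / 3 : ℝ) • c • qi = (t * (c / 3)) • qi := by module
  have hn : ‖d • qi + b • qj‖ = R := by
    have h := Quaternion.normSq_eq_norm_mul_self (d • qi + b • qj)
    rw [Quaternion.normSq_def'] at h
    simp only [Quaternion.re_add, Quaternion.re_smul, Quaternion.imI_add, Quaternion.imI_smul,
      Quaternion.imJ_add, Quaternion.imJ_smul, Quaternion.imK_add, Quaternion.imK_smul, re_qi,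
      re_qj, imI_qi, imI_qj, imJ_qi, imJ_qj, imK_qi, imK_qj, smul_eq_mul] at h
    nlinarith [norm_nonneg (d • qi + b • qj)]
  rw [expCurve, e1, e2, exp_smul_of_re_eq_zero (by simp), hn, ← circ_eq_exp]
  have h1 := Real.cos_add (t * (c / 3)) (t * R)
  have h2 := Real.sin_add (t * (c / 3)) (t * R)
  have h3 := Real.cos_sub (t * (c / 3)) (t * R)
  have h4 := Real.sin_sub (t * (c / 3)) (t * R)
  ext
  all_goals
    simp only [comp3, Quaternion.re_mul, Quaternion.imI_mul, Quaternion.imJ_mul,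
      Quaternion.imK_mul, Quaternion.re_add, Quaternion.re_smul, Quaternion.imI_add,
      Quaternion.imI_smul, Quaternion.imJ_add, Quaternion.imJ_smul, Quaternion.imK_add,
      Quaternion.imK_smul, Quaternion.re_coe, Quaternion.imI_coe, Quaternion.imJ_coe,
      Quaternion.imK_coe, re_qi, re_qj, imI_qi, imI_qj, imJ_qi, imJ_qj, imK_qi, imK_qj,
      smul_eq_mul,
      re_circ, imI_circ, imJ_circ, imK_circ, hA, hB, hφ, w1, w2, w3, h1, h2, h3, h4]
    field_simp
    ring

theorem curve2_eq_expCurve (c₁ : HH) (d₁ t : ℝ) :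
    curve2 c₁ d₁ t = (expCurve (((1 + d₁) / 2 * ‖c₁‖) • qi) (‖c₁‖ • qi) t,
      expCurve (((1 - d₁) / 2 * ‖c₁‖) • qi) (‖c₁‖ • qi) t) := by
  rw [curve2, expCurve_smul_smul, expCurve_smul_smul, circ_eq_exp, circ_eq_exp]

theorem curve1_eq_expCurve (a t : ℝ) :
    curve1 a t = (expCurve (a • qi) 0 t, expCurve (-(a • qi)) 0 t) := by
  have h (a : ℝ) := expCurve_smul_smul a 0 qi t
  simp only [zero_smul] at h
  rw [curve1, ← neg_smul, h, h, circ_eq_exp, circ_eq_exp, neg_mul]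

theorem curve3_eq_expCurve (c₁ : HH) {c₂ : HH} (h₂ : c₂ ≠ 0) (d₁ t : ℝ) :
    curve3 c₁ c₂ d₁ t =
      (expCurve (((1 + d₁) / 2 * ‖c₁‖) • qi + (1 / 2 * ‖c₂‖) • qj) (‖c₁‖ • qi) t,
       expCurve (((1 - d₁) / 2 * ‖c₁‖) • qi + (-(1 / 2) * ‖c₂‖) • qj) (‖c₁‖ • qi) t) := by
  have h := norm_ne_zero_iff.2 h₂
  rw [curve3, comp3_eq_expCurve _ _ _ (by simpa using h),
    comp3_eq_expCurve _ _ _ (by simpa using h)]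

/-! ### Rotations -/

theorem mul_self_of_unit {u : HH} (hu : u.re = 0) (h : ‖u‖ = 1) : u * u = -1 := by
  have := unit_star_mul h
  rw [star_eq_neg_of_re hu, neg_mul] at this
  rw [← this, neg_neg]

theorem mul_anticomm_of_inner {u v : HH} (hu : u.re = 0) (hv : v.re = 0)
    (h : inner ℝ u v = 0) : v * u = -(u * v) := by
  simp only [Quaternion.inner_def, Quaternion.re_mul, Quaternion.re_star, Quaternion.imI_star,
    Quaternion.imJ_star, Quaternion.imK_star, hu, hv] at h
  ext <;> simp [hu, hv] <;> linarith

theorem conj_eq_of_mul_eq {h x u : HH} (hh : h ≠ 0) (e : h * x = u * h) :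
    ((‖h‖)⁻¹ • h) * x * ((‖h‖)⁻¹ • h)⁻¹ = u := by
  have h' : (‖h‖)⁻¹ • h ≠ 0 := smul_ne_zero (inv_ne_zero (norm_ne_zero_iff.2 hh)) hh
  rw [mul_inv_eq_iff_eq_mul₀ h', smul_mul_assoc, e, mul_smul_comm]

/-- Since `u² = i² = -1`, every `h = q - u q i` satisfies `h i = u h`; normalizing a nonzero one
suffices, with no special case for `u = -i`. -/
theorem exists_rotation {u : HH} (hu : u.re = 0) (hn : ‖u‖ = 1) :
    ∃ h : HH, ‖h‖ = 1 ∧ h * qi * h⁻¹ = u := by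
  have hii : qi * qi = -1 := mul_self_of_unit re_qi norm_qi
  have huu := mul_self_of_unit hu hn
  have key (q : HH) : (q - u * q * qi) * qi = u * (q - u * q * qi) := by
    have : (q - u * q * qi) * qi = q * qi - u * q * (qi * qi) := by noncomm_ring
    rw [this, hii]
    have : u * (q - u * q * qi) = u * q - (u * u) * q * qi := by noncomm_ring
    rw [this, huu]; noncomm_ring
  obtain ⟨q, hq⟩ : ∃ q : HH, q - u * q * qi ≠ 0 := by
    -- The map `q ↦ q - u q i` has trace `4`, so it is not zero; the four equations below are its
    -- diagonal entries.
    by_contra! H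
    have a0 : (1 - u * 1 * qi : HH).re = 0 := by rw [H]; rfl
    have a1 : (qi - u * qi * qi : HH).imI = 0 := by rw [H]; rfl
    have a2 : (qj - u * qj * qi : HH).imJ = 0 := by rw [H]; rfl
    have a3 : (qk - u * qk * qi : HH).imK = 0 := by rw [H]; rfl
    simp at a0 a1 a2 a3
    linarith
  exact ⟨(‖q - u * q * qi‖)⁻¹ • (q - u * q * qi), by
    rw [norm_smul, norm_inv, norm_norm, inv_mul_cancel₀ (norm_ne_zero_iff.2 hq)],
    conj_eq_of_mul_eq hq (key q)⟩

theorem norm_qj : ‖qj‖ = 1 := by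
  have := Quaternion.normSq_eq_norm_mul_self qj
  rw [Quaternion.normSq_def'] at this
  simp at this
  nlinarith [norm_nonneg qj]

theorem qi_mul_qj : qi * qj = qk := by ext <;> simp

theorem qj_mul_qi : qj * qi = -qk := by ext <;> simp

theorem qk_mul_qi : qk * qi = qj := by ext <;> simp

theorem qk_mul_qj : qk * qj = -qi := by ext <;> simp

/-- Orthogonality gives `vu = -uv`, so `u, v, uv` multiply like `i, j, k`. Averaging over the
quaternion group, up to a factor, gives `F q`, which intertwines the two actions, and `F` again has
trace `4`. -/
theorem exists_rotation_pair {u v : HH} (hu : u.re = 0) (hv : v.re = 0) (hnu : ‖u‖ = 1)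
    (hnv : ‖v‖ = 1) (huv : inner ℝ u v = 0) :
    ∃ h : HH, ‖h‖ = 1 ∧ h * qi * h⁻¹ = u ∧ h * qj * h⁻¹ = v := by
  have huu := mul_self_of_unit hu hnu
  have hvv := mul_self_of_unit hv hnv
  have hvu := mul_anticomm_of_inner hu hv huv
  have hii : qi * qi = -1 := mul_self_of_unit re_qi norm_qi
  have hjj : qj * qj = -1 := mul_self_of_unit re_qj norm_qj
  obtain ⟨F, hF⟩ : ∃ F : HH → HH, ∀ q, F q = q - u * q * qi - v * q * qj - u * v * q * qk :=
    ⟨_, fun _ => rfl⟩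
  have key1 (q : HH) : F q * qi = u * F q := by
    have e1 : F q * qi = q * qi - u * q * (qi * qi) - v * q * (qj * qi) -
      u * v * q * (qk * qi) := by rw [hF]; noncomm_ring
    have e2 : u * F q = u * q - (u * u) * q * qi - u * v * q * qj - (u * u) * v * q * qk := by
      rw [hF]; noncomm_ring
    rw [e1, e2, hii, qj_mul_qi, qk_mul_qi, huu]; noncomm_ring
  have key2 (q : HH) : F q * qj = v * F q := by
    have e1 : F q * qj = q * qj - u * q * (qi * qj) - v * q * (qj * qj) -
      u * v * q * (qk * qj) := by rw [hF]; noncomm_ring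
    have e2 : v * F q = v * q - (v * u) * q * qi - (v * v) * q * qj - (v * u) * v * q * qk := by
      rw [hF]; noncomm_ring
    have e3 : (v * u) * v = u := by rw [hvu, neg_mul, mul_assoc, hvv]; noncomm_ring
    rw [e1, e2, e3, hjj, qi_mul_qj, qk_mul_qj, hvu, hvv]; noncomm_ring
  obtain ⟨q, hq⟩ : ∃ q : HH, F q ≠ 0 := by
    by_contra! H
    simp only [hF] at H
    have a0 : (1 - u * 1 * qi - v * 1 * qj - u * v * 1 * qk : HH).re = 0 := by rw [H]; rfl
    have a1 : (qi - u * qi * qi - v * qi * qj - u * v * qi * qk : HH).imI = 0 := by rw [H]; rfl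
    have a2 : (qj - u * qj * qi - v * qj * qj - u * v * qj * qk : HH).imJ = 0 := by rw [H]; rfl
    have a3 : (qk - u * qk * qi - v * qk * qj - u * v * qk * qk : HH).imK = 0 := by rw [H]; rfl
    have one_re : (1 : HH).re = 1 := rfl
    simp [hu, hv] at a0 a1 a2 a3
    linarith
  exact ⟨(‖F q‖)⁻¹ • F q, by
    rw [norm_smul, norm_inv, norm_norm, inv_mul_cancel₀ (norm_ne_zero_iff.2 hq)],
    conj_eq_of_mul_eq hq (key1 q), conj_eq_of_mul_eq hq (key2 q)⟩

theorem rot_expCurve {h : HH} (hh : h ≠ 0) (α β c : HH) (t : ℝ) :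
    rot h (expCurve α c t, expCurve β c t) =
      (expCurve (h * α * h⁻¹) (h * c * h⁻¹) t, expCurve (h * β * h⁻¹) (h * c * h⁻¹) t) := by
  rw [rot, expCurve_conj hh, expCurve_conj hh]

theorem re_conj {h a : HH} (hh : h ≠ 0) (ha : a.re = 0) : (h * a * h⁻¹).re = 0 := by
  have comm (x y : HH) : (x * y).re = (y * x).re := by simp only [Quaternion.re_mul]; ring
  rw [comm, ← mul_assoc, inv_mul_cancel₀ hh, one_mul, ha]

theorem eq_zero_of_expCurve_eq_one {α c : HH} (h : ∀ t, expCurve α c t = 1) : α = 0 := by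
  have h1 := hasDerivAt_expCurve α c 0
  rw [show expCurve α c = fun _ => 1 from funext h] at h1
  simpa [expVel] using h1.unique (hasDerivAt_const _ _)

/-- Rotating the curve conjugates its initial data, so the result is again a solution. A constant
curve would have zero initial velocity. -/
theorem isGeodesic_rot_expCurve {h : HH} (hh : h ≠ 0) {α β c : HH} (hα : α.re = 0)
    (hβ : β.re = 0) (hc : α + β = c) (h0 : α ≠ 0 ∨ β ≠ 0) {γ : ℝ → Amb}
    (hγ : ∀ t, γ t = rot h (expCurve α c t, expCurve β c t)) :
    IsGeodesic γ ∧ γ 0 = (1, 1) ∧ ∃ t, γ t ≠ (1, 1) := by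
  simp only [rot_expCurve hh] at hγ
  have hc' : h * c * h⁻¹ = h * α * h⁻¹ + h * β * h⁻¹ := by rw [← hc]; noncomm_ring
  refine ⟨?_, ?_, ?_⟩
  · rw [funext hγ, hc']
    exact isGeodesic_expCurve (re_conj hh hα) (re_conj hh hβ)
  · rw [hγ, expCurve_zero, expCurve_zero]
  · by_contra! H
    simp only [hγ, Prod.mk.injEq] at H
    have e1 := eq_zero_of_expCurve_eq_one fun t => (H t).1
    have e2 := eq_zero_of_expCurve_eq_one fun t => (H t).2
    simp only [mul_eq_zero, hh, inv_eq_zero, or_false, false_or] at e1 e2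
    exact h0.elim (· e1) (· e2)

/-! ### Normal forms of geodesics -/

theorem exists_rot_curve1 {α : HH} (hα : α.re = 0) (h0 : α ≠ 0) :
    ∃ h : HH, ‖h‖ = 1 ∧ ∀ t, (expCurve α 0 t, expCurve (-α) 0 t) = rot h (curve1 ‖α‖ t) := by
  have hn := norm_ne_zero_iff.2 h0
  obtain ⟨h, h1, h2⟩ := exists_rotation (u := (‖α‖)⁻¹ • α) (by simp [hα])
    (by rw [norm_smul, norm_inv, norm_norm, inv_mul_cancel₀ hn])
  have hh : h ≠ 0 := norm_ne_zero_iff.1 (by rw [h1]; norm_num)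
  refine ⟨h, h1, fun t => ?_⟩
  rw [curve1_eq_expCurve, rot_expCurve hh]
  simp only [mul_neg, neg_mul, mul_smul_comm, smul_mul_assoc, h2, smul_smul, mul_zero, zero_mul,
    mul_inv_cancel₀ hn, one_smul]

theorem re_inv_norm_smul {c : HH} (hc : c.re = 0) : ((‖c‖)⁻¹ • c).re = 0 := by
  simp [hc]

theorem norm_inv_norm_smul {c : HH} (hc : c ≠ 0) : ‖(‖c‖)⁻¹ • c‖ = 1 := by
  rw [norm_smul, norm_inv, norm_norm, inv_mul_cancel₀ (norm_ne_zero_iff.2 hc)]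

theorem exists_rot_curve2 {c₁ : HH} (hc : c₁.re = 0) (h0 : c₁ ≠ 0) (d₁ : ℝ) :
    ∃ h : HH, ‖h‖ = 1 ∧ ∀ t, (expCurve (((1 + d₁) / 2) • c₁) c₁ t,
      expCurve (((1 - d₁) / 2) • c₁) c₁ t) = rot h (curve2 c₁ d₁ t) := by
  obtain ⟨h, h1, h2⟩ := exists_rotation (re_inv_norm_smul hc) (norm_inv_norm_smul h0)
  have hh : h ≠ 0 := norm_ne_zero_iff.1 (by rw [h1]; norm_num)
  refine ⟨h, h1, fun t => ?_⟩
  rw [curve2_eq_expCurve, rot_expCurve hh]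
  simp only [mul_smul_comm, smul_mul_assoc, h2, smul_smul, mul_assoc,
    mul_inv_cancel₀ (norm_ne_zero_iff.2 h0), one_smul, mul_one]

theorem exists_rot_curve3 {c₁ c₂ : HH} (hc₁ : c₁.re = 0) (h₁ : c₁ ≠ 0) (hc₂ : c₂.re = 0)
    (h₂ : c₂ ≠ 0) (h₁₂ : inner ℝ c₁ c₂ = 0) (d₁ : ℝ) :
    ∃ h : HH, ‖h‖ = 1 ∧ ∀ t, (expCurve (((1 + d₁) / 2) • c₁ + (1 / 2 : ℝ) • c₂) c₁ t,
      expCurve (((1 - d₁) / 2) • c₁ + (-(1 / 2) : ℝ) • c₂) c₁ t) = rot h (curve3 c₁ c₂ d₁ t) := by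
  obtain ⟨h, h1, h2, h3⟩ := exists_rotation_pair (re_inv_norm_smul hc₁) (re_inv_norm_smul hc₂)
    (norm_inv_norm_smul h₁) (norm_inv_norm_smul h₂)
    (by rw [inner_smul_left, inner_smul_right, h₁₂, mul_zero, mul_zero])
  have hh : h ≠ 0 := norm_ne_zero_iff.1 (by rw [h1]; norm_num)
  refine ⟨h, h1, fun t => ?_⟩
  rw [curve3_eq_expCurve c₁ h₂, rot_expCurve hh]
  simp only [mul_add, add_mul, mul_smul_comm, smul_mul_assoc, h2, h3, smul_smul, mul_assoc,
    mul_inv_cancel₀ (norm_ne_zero_iff.2 h₁), mul_inv_cancel₀ (norm_ne_zero_iff.2 h₂), one_smul,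
    mul_one]

end NearlyKahler

/-! ### Classification of the geodesic lines through the identity, and its converse. -/

theorem theorem3p1 :
    (∀ (γ : ℝ → NearlyKahler.Amb) (t₀ : ℝ),
      NearlyKahler.IsGeodesic γ → γ t₀ = (1, 1) → (∃ t, γ t ≠ (1, 1)) →
      ∀ (α β c₁ c₂ : NearlyKahler.HH) (d₁ : ℝ),
        deriv γ t₀ = (α, β) →
        c₁ = α + β →
        d₁ = inner ℝ (α - β) c₁ / ‖c₁‖ ^ 2 →
        c₂ = α - β - d₁ • c₁ →
        c₁.re = 0 ∧ c₂.re = 0 ∧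
        ∃ h : NearlyKahler.HH, ‖h‖ = 1 ∧
          (c₁ = 0 → ∃ a : ℝ, a ≠ 0 ∧
            ∀ t, γ (t₀ + t) = NearlyKahler.rot h (NearlyKahler.curve1 a t)) ∧
          (c₁ ≠ 0 → c₂ = 0 →
            ∀ t, γ (t₀ + t) = NearlyKahler.rot h (NearlyKahler.curve2 c₁ d₁ t)) ∧
          (c₁ ≠ 0 → c₂ ≠ 0 →
            ∀ t, γ (t₀ + t) = NearlyKahler.rot h (NearlyKahler.curve3 c₁ c₂ d₁ t))) ∧
    (∀ (h : NearlyKahler.HH), ‖h‖ = 1 → ∀ (γ : ℝ → NearlyKahler.Amb),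
      ((∃ a : ℝ, a ≠ 0 ∧ ∀ t, γ t = NearlyKahler.rot h (NearlyKahler.curve1 a t)) ∨
        (∃ (c₁ : NearlyKahler.HH) (d₁ : ℝ), c₁.re = 0 ∧ c₁ ≠ 0 ∧
          ∀ t, γ t = NearlyKahler.rot h (NearlyKahler.curve2 c₁ d₁ t)) ∨
        (∃ (c₁ c₂ : NearlyKahler.HH) (d₁ : ℝ),
          c₁.re = 0 ∧ c₁ ≠ 0 ∧ c₂.re = 0 ∧ c₂ ≠ 0 ∧
          ∀ t, γ t = NearlyKahler.rot h (NearlyKahler.curve3 c₁ c₂ d₁ t))) →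
      NearlyKahler.IsGeodesic γ ∧ γ 0 = (1, 1) ∧ ∃ t, γ t ≠ (1, 1)) := by
  open NearlyKahler in
  constructor
  · intro γ t₀ hγ h0 hne α β c₁ c₂ d₁ hd hc₁ hd₁ hc₂
    have hT := deriv_mem_tangent (hγ.smooth.differentiable (by simp) t₀) hγ.mem
    rw [h0, hd] at hT
    have hα : α.re = 0 := by simpa using re_eq_zero_of_perp hT.1
    have hβ : β.re = 0 := by simpa using re_eq_zero_of_perp hT.2
    have re₁ : c₁.re = 0 := by simp [hc₁, hα, hβ]
    have re₂ : c₂.re = 0 := by simp [hc₂, re₁, hα, hβ]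
    have hsol (t : ℝ) : γ (t₀ + t) = (expCurve α c₁ t, expCurve β c₁ t) := by
      rw [hc₁]
      refine (hγ.comp_const_add t₀).eq_expCurve (by simpa using h0) ?_ t
      rw [deriv_comp_const_add, add_zero, hd]
    refine ⟨re₁, re₂, ?_⟩
    -- Half the sum and half the difference of `α + β = c₁` and `α - β = d₁c₁ + c₂`.
    have eα : α = ((1 + d₁) / 2) • c₁ + (1 / 2 : ℝ) • c₂ := by rw [hc₂, hc₁]; module
    have eβ : β = ((1 - d₁) / 2) • c₁ + (-(1 / 2) : ℝ) • c₂ := by rw [hc₂, hc₁]; module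
    by_cases h₁ : c₁ = 0
    · have hβα : β = -α := by rw [eq_neg_iff_add_eq_zero, add_comm, ← hc₁, h₁]
      have hα0 : α ≠ 0 := by
        rintro rfl
        obtain ⟨t, ht⟩ := hne
        have := hsol (t - t₀)
        rw [add_sub_cancel, hβα, h₁, neg_zero] at this
        exact ht (this.trans (by simp [expCurve]))
      obtain ⟨h, hh, e⟩ := exists_rot_curve1 hα hα0
      refine ⟨h, hh, fun _ => ⟨‖α‖, norm_ne_zero_iff.2 hα0, fun t => ?_⟩,
        fun h => absurd h₁ h, fun h => absurd h₁ h⟩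
      rw [hsol, h₁, hβα, e]
    by_cases h₂ : c₂ = 0
    · obtain ⟨h, hh, e⟩ := exists_rot_curve2 re₁ h₁ d₁
      refine ⟨h, hh, fun h => absurd h h₁, fun _ _ t => ?_, fun _ h => absurd h₂ h⟩
      rw [hsol, ← e]
      rw [h₂, smul_zero, add_zero] at eα eβ
      rw [← eα, ← eβ]
    -- Gram–Schmidt: `d₁` is the coefficient of the projection of `α - β` to `c₁`.
    · have h₁₂ : inner ℝ c₁ c₂ = 0 := by
        have := norm_ne_zero_iff.2 h₁
        rw [hc₂, inner_sub_right, inner_smul_right, real_inner_self_eq_norm_sq, hd₁,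
          real_inner_comm]
        field_simp
        ring
      obtain ⟨h, hh, e⟩ := exists_rot_curve3 re₁ h₁ re₂ h₂ h₁₂ d₁
      refine ⟨h, hh, fun h => absurd h h₁, fun _ h => absurd h h₂, fun _ _ t => ?_⟩
      rw [hsol, ← e, ← eα, ← eβ]
  · intro h hh γ hγ
    have hh0 : h ≠ 0 := norm_ne_zero_iff.1 (by rw [hh]; norm_num)
    -- In forms 2 and 3 the curve is not constant because its initial velocities sum to `‖c₁‖ i`.
    -- Only the norms of `c₁` and `c₂` enter the curves, so the converse needs no orthogonality.
    have ne_of_add {x y : HH} {c₁ : HH} (h₁ : c₁ ≠ 0) (e : x + y = ‖c₁‖ • qi) : x ≠ 0 ∨ y ≠ 0 := by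
      by_contra! H
      rw [H.1, H.2, add_zero] at e
      have := congrArg norm e
      rw [norm_zero, norm_smul, norm_qi, norm_norm, mul_one] at this
      exact h₁ (norm_eq_zero.1 this.symm)
    rcases hγ with ⟨a, ha, e⟩ | ⟨c₁, d₁, -, h₁, e⟩ | ⟨c₁, c₂, d₁, -, h₁, -, h₂, e⟩
    · have hq : a • qi ≠ 0 := smul_ne_zero ha (norm_ne_zero_iff.1 (by rw [norm_qi]; norm_num))
      exact isGeodesic_rot_expCurve hh0 (by simp) (by simp) (add_neg_cancel _) (.inl hq)
        fun t => by rw [e, curve1_eq_expCurve]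
    · have hs : ((1 + d₁) / 2 * ‖c₁‖) • qi + ((1 - d₁) / 2 * ‖c₁‖) • qi = ‖c₁‖ • qi := by module
      exact isGeodesic_rot_expCurve hh0 (by simp) (by simp) hs (ne_of_add h₁ hs)
        fun t => by rw [e, curve2_eq_expCurve]
    · have hs : (((1 + d₁) / 2 * ‖c₁‖) • qi + (1 / 2 * ‖c₂‖) • qj) +
          (((1 - d₁) / 2 * ‖c₁‖) • qi + (-(1 / 2) * ‖c₂‖) • qj) = ‖c₁‖ • qi := by module
      exact isGeodesic_rot_expCurve hh0 (by simp) (by simp) hs (ne_of_add h₁ hs)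
        fun t => by rw [e, curve3_eq_expCurve c₁ h₂]
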